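/- **Setting.** On a probability space $(\Omega,\mathcal F,\mathbb P)$, a positive stock price $S$ ($S_0$ known) is observed and traded only at random dates $0=\tau_0<\tau_1<\tau_2<\cdots$, the jump times of a Poisson process of intensity $\lambda>0$. Let $Z_k=(S_{\tau_k}-S_{\tau_{k-1}})/S_{\tau_{k-1}}$ for $k\ge1$ ($Z_0$ constant). Each waiting time $\tau_k-\tau_{k-1}$ is independent of $(\tau_i,Z_i)_{i<k}$, and conditionally on $\tau_k-\tau_{k-1}=t$ the return $Z_k$ is independent of $(\tau_i,Z_i)_{i<k}$ and has law $p(t,dz)$, where $p$ is a probability kernel from $[0,\infty)$ to $\mathbb R$. There are $\underline z\in(0,1]$ and $\bar z\in(0,\infty]$ such that for each $t\ge 0$ the (closed) support of $p(t,dz)$ is either an interval with interior $(-\underline z,\bar z)$, or ($\bar z<\infty$ and) a finite set with least element $-\underline z$ and greatest element $\bar z$. Moreover, for all $t\ge 0$, $z$ is $p(t,dz)$-integrable, $\int z\,p(t,dz)\ge0$ and $\int(1+z)\,p(t,dz)\le ke^{bt}$ for some constants $k,b\ge0$; and $t\mapsto\int w(z)\,p(t,dz)$ is continuous for every measurable $w$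 of linear growth. The utility $U:[0,\infty)\to\mathbb R$ is strictly increasing, strictly concave, $C^1$ on $(0,\infty)$, with $U(0)=0$, $U'(0^+)=+\infty$, $U'(+\infty)=0$, and $U(x)\le K_1x^\gamma$ for $x\ge0$, for some $K_1>0$, $\gamma\in(0,1)$. The discount rate $\rho>0$ satisfies $\rho>b\gamma+\lambda\left(k^\gamma/\underline z^\gamma-1\right)$. Let $\mathcal G_t=\sigma\{(\tau_k,Z_k):\tau_k\le t\}$. For $x\ge0$ let $\mathcal A(x)$ be the set of pairs $(\alpha,c)$ where $\alpha=(\alpha_k)_{k\ge1}$ is real-valued with $\alpha_k$ being $\mathcal G_{\tau_{k-1}}$-measurable, $c\ge0$ is $(\mathcal G_t)$-predictable, and almost surely, for all $k\ge1$, $\int_0^{\tau_k}c_t\,dt<\infty$ and $x-\int_0^{\tau_k}c_t\,dt+\sum_{i=1}^k\alpha_iZ_i\ge0$. Put $$v(x)=\sup_{(\alpha,c)\in\mathcal A(x)}\mathbb E\left[\int_0^\infty e^{-\rho t}U(c_t)\,dt\right].$$ Let $A=\mathbb R$ if $\bar z<\infty$ and $A=[0,\infty)$ if $\bar z=\infty$.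 For $a\in A$ let $l(a)=\max(a\underline z,-a\bar z)$, read as $a\underline z$ if $\bar z=\infty$. For $t\ge0$ and $x\ge l(a)$, let $\mathcal C_a(t,x)$ be the set of measurable $c:[t,\infty)\to[0,\infty)$ with $\int_t^sc_u\,du\le x-l(a)$ for all $s\ge t$; write $Y_s=x-\int_t^sc_u\,du$. The auxiliary problem at $(t,x)$ is $$\hat v(t,x,a)=\sup_{c\in\mathcal C_a(t,x)}\int_t^\infty e^{-(\rho+\lambda)(s-t)}\left[U(c_s)+\lambda\int v(Y_s+az)\,p(s,dz)\right]ds .$$ **Proposition (stationary case).** Assume in addition that $p(t,dz)=p(dz)$ does not depend on $t$. Let $a\in A$, $t\ge0$ and $x\ge l(a)$. Then the auxiliary problem at $(t,x)$ has an optimal control $\bar c$, unique up to equality almost everywhere on $[t,\infty)$; it can be chosen on $[t,\infty)$ so that, with $\bar Y_s=x-\int_t^s\bar c_u\,du$, the following hold. * If $x=l(a)$, then $\bar c\equiv0$ and $\bar Y\equiv l(a)$ on $[t,\infty)$. * If $x>l(a)$, then on $[t,\infty)$ the function $\bar c$ is continuous, strictly positive and strictly decreasing, and $\bar Y$ is strictly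 decreasing and strictly convex. Moreover $\lim_{s\to\infty}\bar c_s=0$ and $\lim_{s\to\infty}\bar Y_s=l(a)$. -/

import Mathlib

open MeasureTheory ProbabilityTheory Set Filter Topology
open scoped NNReal ENNReal

noncomputable section

namespace IlliquidMarket

/-- A positive stock price process `S` (with known initial price) together with random trading
dates `0 = τ₀ < τ₁ < τ₂ < ⋯`. -/
structure Market (Ω : Type*) [MeasurableSpace Ω] where
  /-- stock price -/
  S : ℝ≥0 → Ω → ℝ
  /-- trading dates -/
  τ : ℕ → Ω → ℝ≥0
  S_pos : ∀ t ω, 0 < S t ω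
  S_init : ∃ s₀ : ℝ, ∀ ω, S 0 ω = s₀
  τ_zero : ∀ ω, τ 0 ω = 0
  τ_strictMono : ∀ ω, StrictMono fun k => τ k ω
  measurable_τ : ∀ k, Measurable (τ k)
  measurable_S_τ : ∀ k, Measurable fun ω => S (τ k ω) ω

namespace Market

variable {Ω : Type*} [MeasurableSpace Ω]

/-- The observed returns `Z_k = (S_{τ_k} - S_{τ_{k-1}}) / S_{τ_{k-1}}` for `k ≥ 1`
(for `k = 0` truncated subtraction gives the constant `Z₀ = 0`). -/
def Z (M : Market Ω) (k : ℕ) (ω : Ω) : ℝ :=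
  (M.S (M.τ k ω) ω - M.S (M.τ (k - 1) ω) ω) / M.S (M.τ (k - 1) ω) ω

/-- The waiting time `τ_{k+1} - τ_k`. -/
def wait (M : Market Ω) (k : ℕ) (ω : Ω) : ℝ≥0 := M.τ (k + 1) ω - M.τ k ω

/-- The observations `(τ_i, Z_i)`, `0 ≤ i ≤ k`. -/
def history (M : Market Ω) (k : ℕ) (ω : Ω) : Fin (k + 1) → ℝ≥0 × ℝ :=
  fun i => (M.τ i ω, M.Z i ω)

theorem measurable_Z (M : Market Ω) (k : ℕ) : Measurable (M.Z k) :=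
  ((M.measurable_S_τ k).sub (M.measurable_S_τ (k - 1))).div (M.measurable_S_τ (k - 1))

/-- The continuous observation filtration `𝒢_t = σ{(τ_k, Z_k) : τ_k ≤ t}`, generated by the events
`{τ_k ≤ s, Z_k ∈ B}` with `s ≤ t` and `B` Borel. -/
def obs (M : Market Ω) : Filtration ℝ≥0 (inferInstance : MeasurableSpace Ω) where
  seq t := MeasurableSpace.generateFrom
    {A | ∃ (k : ℕ) (s : ℝ≥0) (B : Set ℝ), s ≤ t ∧ MeasurableSet B ∧
      A = {ω | M.τ k ω ≤ s ∧ M.Z k ω ∈ B}}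
  mono' := by
    intro t u htu
    apply MeasurableSpace.generateFrom_mono
    rintro A ⟨k, s, B, hs, hB, rfl⟩
    exact ⟨k, s, B, hs.trans htu, hB, rfl⟩
  le' := by
    intro t
    apply MeasurableSpace.generateFrom_le
    rintro A ⟨k, s, B, hs, hB, rfl⟩
    exact (measurableSet_le (M.measurable_τ k) measurable_const).inter (M.measurable_Z k hB)

theorem isStoppingTime_τ (M : Market Ω) (k : ℕ) :
    IsStoppingTime M.obs fun ω => (M.τ k ω : WithTop ℝ≥0) := by
  intro t
  apply MeasurableSpace.measurableSet_generateFrom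
  exact ⟨k, t, univ, le_rfl, MeasurableSet.univ, by
    ext ω
    simp only [mem_ofPred_eq, mem_univ, and_true]
    exact WithTop.coe_le_coe (α := ℝ≥0)⟩

/-- The discrete observation filtration `𝒢_{τ_k}`. -/
@[reducible] def discreteObs (M : Market Ω) (k : ℕ) : MeasurableSpace Ω :=
  (M.isStoppingTime_τ k).measurableSpace

/-- Wealth at the date `τ_k`: `X_k = x - ∫₀^{τ_k} c_t dt + ∑_{i=1}^k α_i Z_i`. -/
def wealth (M : Market Ω) (x : ℝ) (α : ℕ → Ω → ℝ) (c : ℝ≥0 → Ω → ℝ) (k : ℕ) (ω : Ω) : ℝ :=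
  x - (∫ t in (0 : ℝ)..(M.τ k ω : ℝ), c t.toNNReal ω) + ∑ i ∈ Finset.Icc 1 k, α i ω * M.Z i ω

/-- Admissible control policies `(α, c) ∈ 𝒜(x)`: `α_k` (`k ≥ 1`) is `𝒢_{τ_{k-1}}`-measurable,
`c` is a nonnegative predictable process for the continuous observation filtration, and almost
surely the wealth at every trading date is well defined (finite consumption) and nonnegative. -/
structure Admissible (M : Market Ω) (P : Measure Ω) (x : ℝ) (α : ℕ → Ω → ℝ)
    (c : ℝ≥0 → Ω → ℝ) : Prop where
  measurable_α : ∀ k, Measurable[M.discreteObs k] (α (k + 1))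
  predictable_c : IsStronglyPredictable M.obs c
  c_nonneg : ∀ t ω, 0 ≤ c t ω
  wealth_nonneg : ∀ k, 1 ≤ k → ∀ᵐ ω ∂P,
    IntervalIntegrable (fun t : ℝ => c t.toNNReal ω) volume 0 (M.τ k ω) ∧
      0 ≤ M.wealth x α c k ω

/-- The value function
`v(x) = sup_{(α, c) ∈ 𝒜(x)} E[∫₀^∞ e^{-ρ t} U(c_t) dt]`, with values in `[0, ∞]`. -/
def value (M : Market Ω) (P : Measure Ω) (U : ℝ → ℝ) (ρ : ℝ) (x : ℝ) : ℝ≥0∞ :=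
  ⨆ (α : ℕ → Ω → ℝ) (c : ℝ≥0 → Ω → ℝ) (_ : M.Admissible P x α c),
    ∫⁻ ω, (∫⁻ t in Ioi (0 : ℝ), ENNReal.ofReal (Real.exp (-ρ * t) * U (c t.toNNReal ω))) ∂P

end Market

/-- The standing assumptions on the observations `(τ_k, Z_k)`. Here `lam` is the intensity of the
Poisson process of trading dates, `p t` is the conditional law of a return given that the waiting
time is `t`, `zlo = z̲`, `zhi = z̄ ∈ (0, ∞]`, and `k`, `b` are the growth constants. -/
structure ObservationAssumptions {Ω : Type*} [MeasurableSpace Ω] (M : Market Ω) (P : Measure Ω)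
    (lam : ℝ) (p : Kernel ℝ≥0 ℝ) (zlo : ℝ) (zhi : EReal) (k b : ℝ) : Prop where
  lam_pos : 0 < lam
  markov : IsMarkovKernel p
  /-- The trading dates are the jump times of a Poisson process with intensity `lam`: the waiting
  times are exponential, each of them independent of the observations made before it. -/
  wait_law : ∀ n, HasLaw (fun ω => (M.wait n ω : ℝ)) (expMeasure lam) P
  wait_indep : ∀ n, IndepFun (M.history n) (M.wait n) P
  /-- Given `τ_{n+1} - τ_n = t`, the return `Z_{n+1}` is independent of the past observations and
  has law `p t`. -/
  return_law : ∀ n, HasCondDistrib (M.Z (n + 1)) (fun ω => (M.history n ω, M.wait n ω))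
    (Kernel.prodMkLeft (Fin (n + 1) → ℝ≥0 × ℝ) p) P
  zlo_pos : 0 < zlo
  zlo_le_one : zlo ≤ 1
  zhi_pos : 0 < zhi
  support : ∀ t,
    ((p t).support.OrdConnected ∧
      interior (p t).support = {y : ℝ | -zlo < y ∧ (y : EReal) < zhi}) ∨
    (zhi ≠ ⊤ ∧ (p t).support.Finite ∧ IsLeast (p t).support (-zlo) ∧
      IsGreatest (p t).support zhi.toReal)
  k_nonneg : 0 ≤ k
  b_nonneg : 0 ≤ b
  integrable : ∀ t, Integrable (fun z : ℝ => z) (p t)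
  mean_nonneg : ∀ t, 0 ≤ ∫ z, z ∂(p t)
  mean_growth : ∀ t : ℝ≥0, ∫ z, (1 + z) ∂(p t) ≤ k * Real.exp (b * t)
  continuity : ∀ w : ℝ → ℝ, Measurable w → (∃ C : ℝ, ∀ z, |w z| ≤ C * (1 + |z|)) →
    Continuous fun t : ℝ≥0 => ∫ z, w z ∂(p t)

/-- The assumptions on the utility function `U` on `[0, ∞)`. -/
structure UtilityAssumptions (U : ℝ → ℝ) (γ K₁ : ℝ) : Prop where
  strictMono : StrictMonoOn U (Ici 0)
  strictConcave : StrictConcaveOn ℝ (Ici 0) U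
  contDiff : ContDiffOn ℝ 1 U (Ioi 0)
  zero : U 0 = 0
  inada_zero : Tendsto (deriv U) (𝓝[>] 0) atTop
  inada_top : Tendsto (deriv U) atTop (𝓝 0)
  γ_pos : 0 < γ
  γ_lt_one : γ < 1
  K₁_pos : 0 < K₁
  growth : ∀ x, 0 ≤ x → U x ≤ K₁ * x ^ γ

/-- The set `A` of possible investments: `ℝ` if `z̄ < ∞` and `[0, ∞)` if `z̄ = ∞`. -/
def investSet (zhi : EReal) : Set ℝ := {a | zhi = ⊤ → 0 ≤ a}

open Classical in
/-- `l(a) = max(a z̲, -a z̄)`, read as `a z̲` if `z̄ = ∞`. -/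
def minWealth (zlo : ℝ) (zhi : EReal) (a : ℝ) : ℝ :=
  if zhi = ⊤ then a * zlo else max (a * zlo) (-a * zhi.toReal)

/-- The deterministic wealth `Y_s^{t,x} = x - ∫_t^s c_u du`. -/
def wealthPath (t x : ℝ) (c : ℝ → ℝ) (s : ℝ) : ℝ := x - ∫ u in t..s, c u

/-- The set `𝒞_a(t, x)` of nonnegative deterministic consumption rates `c` with
`∫_t^s c_u du ≤ x - l` for all `s ≥ t`, where `l = l(a)`. -/
def consumptions (l t x : ℝ) : Set (ℝ → ℝ) :=
  {c | Measurable c ∧ (∀ s, t ≤ s → 0 ≤ c s) ∧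
    ∀ s, t ≤ s → IntervalIntegrable c volume t s ∧ ∫ u in t..s, c u ≤ x - l}

section Auxiliary

variable {Ω : Type*} [MeasurableSpace Ω]

/-- `g(t, x, a) = λ ∫ v(x + a z) p(t, dz)`. -/
def gFun (M : Market Ω) (P : Measure Ω) (U : ℝ → ℝ) (ρ lam : ℝ) (p : Kernel ℝ≥0 ℝ)
    (t x a : ℝ) : ℝ≥0∞ :=
  ENNReal.ofReal lam * ∫⁻ z, M.value P U ρ (x + a * z) ∂(p t.toNNReal)

/-- The objective of the auxiliary problem,
`∫_t^∞ e^{-(ρ+λ)(s-t)} [U(c_s) + g(s, Y_s^{t,x}, a)] ds`. -/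
def auxPayoff (M : Market Ω) (P : Measure Ω) (U : ℝ → ℝ) (ρ lam : ℝ) (p : Kernel ℝ≥0 ℝ)
    (t x a : ℝ) (c : ℝ → ℝ) : ℝ≥0∞ :=
  ∫⁻ s in Ioi t, ENNReal.ofReal (Real.exp (-(ρ + lam) * (s - t))) *
    (ENNReal.ofReal (U (c s)) + gFun M P U ρ lam p s (wealthPath t x c s) a)

/-- The auxiliary value function `v̂(t, x, a)`. -/
def auxValue (M : Market Ω) (P : Measure Ω) (U : ℝ → ℝ) (ρ lam : ℝ) (p : Kernel ℝ≥0 ℝ)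
    (zlo : ℝ) (zhi : EReal) (t x a : ℝ) : ℝ≥0∞ :=
  ⨆ c ∈ consumptions (minWealth zlo zhi a) t x, auxPayoff M P U ρ lam p t x a c

/-- `c` is an optimal consumption rate for the auxiliary problem started at `(t, x)`. -/
def IsOptimal (M : Market Ω) (P : Measure Ω) (U : ℝ → ℝ) (ρ lam : ℝ) (p : Kernel ℝ≥0 ℝ)
    (zlo : ℝ) (zhi : EReal) (t x a : ℝ) (c : ℝ → ℝ) : Prop :=
  c ∈ consumptions (minWealth zlo zhi a) t x ∧
    auxPayoff M P U ρ lam p t x a c = auxValue M P U ρ lam p zlo zhi t x a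

end Auxiliary

end IlliquidMarket

end

/-! Stationarity makes the reward `gFun` independent of time. Measuring time from `t` and wealth
above `l(a)` therefore gives an autonomous problem: maximise `∫ e^{-δs} (U(c_s) + G(Y_s)) ds` with
`δ = ρ + λ`, `Y' = -c` and `Y ≥ 0`. About `G` only finiteness, nonnegativity, monotonicity and
concavity are used. Finiteness is the probabilistic part (`exists_value_le`): policies are functions
of past observations, Jensen's inequality controls the `γ`-th moment of wealth over one period, and
the condition on `ρ` makes the resulting geometric series converge. Concavity comes from mixing
policies (`Market.value_concave`).

The value `w` of the autonomous problem is not known to be smooth at the outset. It is concave, so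
its left derivative `D` is a supergradient, and two dynamic programming inequalities give the
Hamilton-Jacobi-Bellman equation `U(C) - C D = δ w - G` with `U'(C) = D` (`optValue_hjb`). Since `c
↦ U(c) - c U'(c)` is strictly increasing and the right side is continuous, `C` is continuous, and
then `w` is `C¹`. The Inada condition at `0` passes from `U` to `w` (`marginalValue_ge`).

The optimal wealth solves `Y' = -C(Y)`, by separation of variables. Differences of the equation for
`w` give a Grönwall bound on `D` along the trajectory; as `D` blows up at `0`, wealth `0` is not
reached in finite time (`exists_trajectory`). Differentiating `e^{-δs} w(Y_s)` shows that this
trajectory is optimal. Uniqueness follows from strict concavity of `U` (`ae_eq_of_optimal`). The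
same argument makes `D` strictly decreasing: equal slopes at two wealth levels would force equal
consumption, although both wealths tend to `0`. Hence `C` is strictly increasing, which gives strict
decrease of consumption and strict convexity of wealth. -/

noncomputable section

namespace IlliquidMarket

/-! ### Policies as functions of the observed history. -/

namespace Market

variable {Ω : Type*} [MeasurableSpace Ω]

theorem measurable_history (M : Market Ω) (k : ℕ) : Measurable (M.history k) :=
  measurable_pi_lambda _ fun i => (M.measurable_τ i).prodMk (M.measurable_Z i)

/-- Between two consecutive trading dates the observation filtration carries no more information
than the finite history. -/
theorem exists_trace_eq_history (M : Market Ω) (k : ℕ) (q : ℝ≥0) {s : Set Ω}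
    (hs : MeasurableSet[M.obs q] s) :
    ∃ B : Set (Fin (k + 1) → ℝ≥0 × ℝ), MeasurableSet B ∧
      ∀ ω, M.τ k ω ≤ q → q < M.τ (k + 1) ω → (ω ∈ s ↔ M.history k ω ∈ B) := by
  induction s, hs using MeasurableSpace.generateFrom_induction with
  | hC s hs =>
    obtain ⟨j, r, B, hr, hB, rfl⟩ := hs
    by_cases hj : j < k + 1
    · have hm : Measurable fun h : Fin (k + 1) → ℝ≥0 × ℝ => h ⟨j, hj⟩ := measurable_pi_apply _
      exact ⟨{h | (h ⟨j, hj⟩).1 ≤ r ∧ (h ⟨j, hj⟩).2 ∈ B},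
        (measurableSet_le hm.fst measurable_const).inter (hm.snd hB), fun ω _ _ => Iff.rfl⟩
    -- For `j > k` the event forces `τ (k + 1) ≤ τ j ≤ q`, so it does not meet `{q < τ (k + 1)}`.
    · refine ⟨∅, MeasurableSet.empty, fun ω _ h2 => ?_⟩
      simp only [mem_ofPred_eq, mem_empty_iff_false, iff_false, not_and]
      intro h
      have := (M.τ_strictMono ω).monotone (not_lt.1 hj)
      exact absurd (h2.trans_le (this.trans (h.trans hr))) (lt_irrefl _)
  | empty => exact ⟨∅, MeasurableSet.empty, fun ω _ _ => Iff.rfl⟩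
  | compl s _ ih =>
    obtain ⟨B, hB, h⟩ := ih
    exact ⟨Bᶜ, hB.compl, fun ω h1 h2 => not_congr (h ω h1 h2)⟩
  | iUnion s _ ih =>
    choose B hB h using ih
    refine ⟨⋃ n, B n, MeasurableSet.iUnion hB, fun ω h1 h2 => ?_⟩
    simp only [mem_iUnion]
    exact exists_congr fun n => h n ω h1 h2

/-- The trace lemma needs a deterministic time in `[τ k, τ (k + 1))`. The grid point `(⌊(n + 1) τ k⌋
+ 1) / (n + 1)` is a countably valued function of the history and lies in that interval once `1 / (n
+ 1)` is below the waiting time. Membership in `s` is thus eventual membership in the sets `E n`. -/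
theorem discreteObs_le_comap_history (M : Market Ω) (k : ℕ) :
    M.discreteObs k ≤ MeasurableSpace.comap (M.history k) inferInstance := by
  intro s hs
  have hq : ∀ q : ℝ≥0, MeasurableSet[M.obs q] (s ∩ {ω | (M.τ k ω : WithTop ℝ≥0) ≤ q}) :=
    fun q => hs.2 q
  choose B hB h using fun q => M.exists_trace_eq_history k q (hq q)
  have h' : ∀ q ω, M.τ k ω ≤ q → q < M.τ (k + 1) ω → (ω ∈ s ↔ M.history k ω ∈ B q) := by
    intro q ω h1 h2
    rw [← h q ω h1 h2]
    exact ⟨fun hω => ⟨hω, WithTop.coe_le_coe.2 h1⟩, And.left⟩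
  let N : ℕ → (Fin (k + 1) → ℝ≥0 × ℝ) → ℕ := fun n x => ⌊((n : ℝ≥0) + 1) * (x (Fin.last k)).1⌋₊
  have hN : ∀ n, Measurable (N n) := fun n =>
    Nat.measurable_floor.comp (measurable_const.mul (measurable_pi_apply (Fin.last k)).fst)
  let q : ℕ → ℕ → ℝ≥0 := fun n j => ((j : ℝ≥0) + 1) / ((n : ℝ≥0) + 1)
  let E : ℕ → Set (Fin (k + 1) → ℝ≥0 × ℝ) := fun n => {x | x ∈ B (q n (N n x))}
  have hE : ∀ n, MeasurableSet (E n) := by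
    intro n
    have : E n = ⋃ j, (N n) ⁻¹' {j} ∩ B (q n j) := by
      ext x; simp [E]
    rw [this]
    exact MeasurableSet.iUnion fun j => (hN n (measurableSet_singleton j)).inter (hB _)
  refine ⟨⋃ m, ⋂ n, E (m + n),
    MeasurableSet.iUnion fun m => MeasurableSet.iInter fun n => hE _, ?_⟩
  ext ω
  have hlast : (M.history k ω (Fin.last k)).1 = M.τ k ω := rfl
  have hlt : M.τ k ω < M.τ (k + 1) ω := M.τ_strictMono ω (Nat.lt_succ_self k)
  have hev : ∀ᶠ n : ℕ in atTop, (ω ∈ s ↔ M.history k ω ∈ E n) := by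
    have hpos : 0 < (M.τ (k + 1) ω : ℝ) - M.τ k ω := sub_pos.2 (by exact_mod_cast hlt)
    filter_upwards [(tendsto_one_div_add_atTop_nhds_zero_nat (𝕜 := ℝ)).eventually_lt_const hpos]
      with n hn
    have hn0 : (0 : ℝ) < (n : ℝ) + 1 := by positivity
    apply h'
    · simp only [q, N, hlast]
      rw [le_div_iff₀ (by positivity), mul_comm]
      exact (Nat.lt_floor_add_one _).le
    · simp only [q, N, hlast]
      rw [div_lt_iff₀ (by positivity)]
      have h1 : ((⌊((n : ℝ≥0) + 1) * M.τ k ω⌋₊ : ℝ≥0) : ℝ) ≤ ((n : ℝ) + 1) * M.τ k ω := by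
        exact_mod_cast Nat.floor_le (zero_le (a := ((n : ℝ≥0) + 1) * M.τ k ω))
      rw [div_lt_iff₀ hn0] at hn
      rw [← NNReal.coe_lt_coe]
      push_cast at h1 ⊢
      nlinarith
  obtain ⟨m, hm⟩ := eventually_atTop.1 hev
  simp only [mem_preimage, mem_iUnion, mem_iInter]
  constructor
  · rintro ⟨i, hi⟩
    exact (hm (i + m) (by omega)).2 (hi m)
  · intro hω
    exact ⟨m, fun n => (hm (m + n) (by omega)).1 hω⟩

theorem Admissible.exists_eq_history {M : Market Ω} {P : Measure Ω} {x : ℝ} {α : ℕ → Ω → ℝ}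
    {c : ℝ≥0 → Ω → ℝ} (h : M.Admissible P x α c) (k : ℕ) :
    ∃ f : (Fin (k + 1) → ℝ≥0 × ℝ) → ℝ, Measurable f ∧ α (k + 1) = f ∘ M.history k :=
  ((h.measurable_α k).mono (M.discreteObs_le_comap_history k) le_rfl).exists_eq_measurable_comp

end Market

/-! ### One-period estimates: discounting and power moments. -/

theorem lintegral_exp_neg_mul_expMeasure {lam ρ : ℝ} (hlam : 0 < lam) (hρ : 0 < ρ) :
    ∫⁻ t, ENNReal.ofReal (Real.exp (-ρ * t)) ∂(expMeasure lam) =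
      ENNReal.ofReal (lam / (lam + ρ)) := by
  have h1 : ∀ t, exponentialPDF lam t * ENNReal.ofReal (Real.exp (-ρ * t)) =
      ENNReal.ofReal (lam / (lam + ρ)) * exponentialPDF (lam + ρ) t := by
    intro t
    rw [exponentialPDF_eq, exponentialPDF_eq, ← ENNReal.ofReal_mul (by split_ifs <;> positivity),
      ← ENNReal.ofReal_mul (by positivity)]
    congr 1
    split_ifs with h
    · rw [mul_assoc, ← Real.exp_add, ← mul_assoc, div_mul_cancel₀ _ (by positivity)]
      ring_nf
    · simp
  have h2 : expMeasure lam = volume.withDensity (exponentialPDF lam) := rfl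
  rw [h2, lintegral_withDensity_eq_lintegral_mul]
  · simp only [Pi.mul_apply, h1]
    rw [lintegral_const_mul, lintegral_exponentialPDF_eq_one (by positivity), mul_one]
    exact (measurable_exponentialPDFReal _).ennreal_ofReal
  · exact (measurable_exponentialPDFReal _).ennreal_ofReal
  · fun_prop

/-- By Jensen it suffices to bound the mean wealth `w + a m` by `(k / zlo) w`. A long position
satisfies `a zlo ≤ w`, because wealth stays nonnegative at the worst return; a short position does
not gain on average, and `zlo ≤ 1 ≤ 1 + m ≤ k`. -/
theorem lintegral_rpow_affine_le {μ : Measure ℝ} [IsProbabilityMeasure μ] {zlo k γ w a : ℝ}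
    (hz0 : 0 < zlo) (hz1 : zlo ≤ 1) (hzmem : -zlo ∈ μ.support) (hint : Integrable (fun z => z) μ)
    (hmean : 0 ≤ ∫ z, z ∂μ) (hk : ∫ z, (1 + z) ∂μ ≤ k) (hγ0 : 0 < γ) (hγ1 : γ < 1)
    (hpos : ∀ᵐ z ∂μ, 0 ≤ w + a * z) :
    ∫⁻ z, ENNReal.ofReal ((w + a * z) ^ γ) ∂μ ≤
      ENNReal.ofReal ((k / zlo) ^ γ) * ENNReal.ofReal (w ^ γ) := by
  -- An almost sure closed condition holds at every point of the support.
  have hwa : 0 ≤ w + a * (-zlo) := by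
    have hcl : IsClosed {z : ℝ | 0 ≤ w + a * z} := isClosed_le (by fun_prop) (by fun_prop)
    exact Measure.support_subset_of_isClosed hcl hpos hzmem
  have hint1 : Integrable (fun z => w + a * z) μ := (integrable_const _).add (hint.const_mul a)
  set m := ∫ z, z ∂μ with hm
  have hI1 : ∫ z, (1 + z) ∂μ = 1 + m := by
    rw [integral_add (integrable_const _) hint]; simp [hm]
  have hI2 : ∫ z, (w + a * z) ∂μ = w + a * m := by
    rw [integral_add (integrable_const _) (hint.const_mul a), integral_const_mul]; simp [hm]
  rw [hI1] at hk
  have hI0 : 0 ≤ w + a * m := hI2 ▸ integral_nonneg_of_ae hpos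
  have hw : 0 ≤ w := by
    rcases le_total 0 a with h | h
    · nlinarith
    · nlinarith
  have hbound : w + a * m ≤ k / zlo * w := by
    rw [div_mul_eq_mul_div, le_div_iff₀ hz0]
    rcases le_total 0 a with h | h
    · nlinarith [mul_nonneg hmean (by linarith : (0 : ℝ) ≤ w - a * zlo),
        mul_le_mul_of_nonneg_right hk hw]
    · have h1 : a * m ≤ 0 := mul_nonpos_of_nonpos_of_nonneg h hmean
      have h2 : (w + a * m) * zlo ≤ w * 1 :=
        mul_le_mul (by linarith) hz1 hz0.le hw
      nlinarith [mul_le_mul_of_nonneg_right hk hw]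
  have hint2 : Integrable (fun z => (w + a * z) ^ γ) μ := by
    refine ((integrable_const (1 : ℝ)).add hint1).mono'
      ((by fun_prop : Measurable fun z : ℝ => (w + a * z) ^ γ).aestronglyMeasurable) ?_
    filter_upwards [hpos] with z hz
    rw [Real.norm_of_nonneg (Real.rpow_nonneg hz _)]
    simp only [Pi.add_apply]
    rcases le_total (w + a * z) 1 with h | h
    · linarith [Real.rpow_le_one hz h hγ0.le]
    · calc (w + a * z) ^ γ ≤ (w + a * z) ^ (1 : ℝ) :=
            Real.rpow_le_rpow_of_exponent_le h hγ1.le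
        _ ≤ 1 + (w + a * z) := by rw [Real.rpow_one]; linarith
  have hJ : ∫ z, (w + a * z) ^ γ ∂μ ≤ (w + a * m) ^ γ := by
    rw [← hI2]
    exact (Real.concaveOn_rpow hγ0.le hγ1.le).le_map_integral
      (Real.continuous_rpow_const hγ0.le).continuousOn isClosed_Ici hpos hint1 hint2
  have hk0 : 0 ≤ k / zlo := div_nonneg (by linarith) hz0.le
  rw [← ENNReal.ofReal_mul (Real.rpow_nonneg hk0 _), ← Real.mul_rpow hk0 hw,
    ← ofReal_integral_eq_lintegral_ofReal hint2
      (hpos.mono fun z hz => Real.rpow_nonneg hz _)]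
  exact ENNReal.ofReal_le_ofReal (hJ.trans (Real.rpow_le_rpow hI0 hbound hγ0.le))

/-! ### Consequences of the support condition on returns. -/

section Support

variable {Ω : Type*} [MeasurableSpace Ω] {M : Market Ω} {P : Measure Ω} {lam : ℝ}
  {p : Kernel ℝ≥0 ℝ} {zlo : ℝ} {zhi : EReal} {k b : ℝ}

theorem ObservationAssumptions.neg_zlo_mem_support
    (h : ObservationAssumptions M P lam p zlo zhi k b) (t : ℝ≥0) : -zlo ∈ (p t).support := by
  rcases h.support t with ⟨_, hint⟩ | ⟨_, _, hl, _⟩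
  · have hsub : {y : ℝ | -zlo < y ∧ (y : EReal) < zhi} ⊆ (p t).support :=
      hint ▸ interior_subset
    refine Measure.isClosed_support.closure_subset_iff.2 hsub ?_
    refine mem_closure_of_tendsto (b := 𝓝[>] (-zlo)) (f := fun y : ℝ => y)
      (tendsto_id.mono_left nhdsWithin_le_nhds) ?_
    have h0 : (-zlo : ℝ) < 0 := by linarith [h.zlo_pos]
    filter_upwards [Ioo_mem_nhdsGT h0] with y hy
    exact ⟨hy.1, lt_trans (by exact_mod_cast hy.2) h.zhi_pos⟩
  · exact hl.1

/-- In the interval case a support point beyond an endpoint, joined to `0` by order-connectedness,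
would put points at or beyond that endpoint in the interior of the support. -/
theorem ObservationAssumptions.ae_mem_Icc
    (h : ObservationAssumptions M P lam p zlo zhi k b) (t : ℝ≥0) :
    ∀ᵐ z ∂(p t), -zlo ≤ z ∧ (z : EReal) ≤ zhi := by
  have hae : ∀ᵐ z ∂(p t), z ∈ (p t).support := Measure.support_mem_ae
  filter_upwards [hae] with z hz
  rcases h.support t with ⟨hc, hint⟩ | ⟨htop, _, hl, hg⟩
  · have hzlo := h.zlo_pos
    have h0 : (0 : ℝ) ∈ (p t).support := by
      apply interior_subset
      rw [hint]
      exact ⟨by linarith, by exact_mod_cast h.zhi_pos⟩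
    have hmem : ∀ u v y : ℝ, u ∈ (p t).support → v ∈ (p t).support → u < y → y < v →
        -zlo < y ∧ (y : EReal) < zhi := by
      intro u v y hu hv h1 h2
      have : y ∈ interior (p t).support :=
        interior_mono (hc.out hu hv) (by rw [interior_Icc]; exact ⟨h1, h2⟩)
      rwa [hint] at this
    constructor
    · by_contra! hlt
      have := (hmem z 0 (-zlo) hz h0 hlt (by linarith)).1
      exact lt_irrefl _ this
    · by_contra! hlt
      obtain ⟨y, h1, h2⟩ := EReal.lt_iff_exists_real_btwn.1 hlt
      have hy0 : (0 : ℝ) < y := by exact_mod_cast h.zhi_pos.trans h1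
      have := (hmem 0 z y h0 hz hy0 (by exact_mod_cast h2)).2
      exact lt_asymm this h1
  · refine ⟨hl.2 hz, ?_⟩
    have hbot : zhi ≠ ⊥ := (bot_le.trans_lt h.zhi_pos).ne'
    rw [← EReal.coe_toReal htop hbot]
    exact_mod_cast hg.2 hz

/-- The worst return is `-zlo` for `a ≥ 0` and `zhi` for `a ≤ 0`; if `zhi = ⊤`, membership in
`investSet` excludes `a < 0`. -/
theorem ObservationAssumptions.ae_minWealth_add_nonneg
    (h : ObservationAssumptions M P lam p zlo zhi k b) (t : ℝ≥0) {a : ℝ} (ha : a ∈ investSet zhi) :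
    ∀ᵐ z ∂(p t), 0 ≤ minWealth zlo zhi a + a * z := by
  filter_upwards [h.ae_mem_Icc t] with z hz
  have hbot : zhi ≠ ⊥ := (bot_le.trans_lt h.zhi_pos).ne'
  unfold minWealth
  split_ifs with htop
  · nlinarith [ha htop, hz.1]
  · have h2 : z ≤ zhi.toReal := by
      rw [← EReal.coe_toReal htop hbot] at hz
      exact_mod_cast hz.2
    rcases le_total 0 a with h0 | h0
    · nlinarith [le_max_left (a * zlo) (-a * zhi.toReal), hz.1]
    · nlinarith [le_max_right (a * zlo) (-a * zhi.toReal)]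

end Support

/-! ### Wealth from trading alone. -/

namespace Market

variable {Ω : Type*} [MeasurableSpace Ω]

/-- The wealth at the date `τ_k` of an investor who does not consume. -/
def tradingWealth (M : Market Ω) (x : ℝ) (α : ℕ → Ω → ℝ) (k : ℕ) (ω : Ω) : ℝ :=
  x + ∑ i ∈ Finset.Icc 1 k, α i ω * M.Z i ω

theorem tradingWealth_succ (M : Market Ω) (x : ℝ) (α : ℕ → Ω → ℝ) (k : ℕ) (ω : Ω) :
    M.tradingWealth x α (k + 1) ω = M.tradingWealth x α k ω + α (k + 1) ω * M.Z (k + 1) ω := by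
  unfold tradingWealth
  rw [Finset.sum_Icc_succ_top (by omega), add_assoc]

theorem comap_history_mono (M : Market Ω) {j k : ℕ} (hjk : j ≤ k) :
    MeasurableSpace.comap (M.history j) inferInstance ≤
      MeasurableSpace.comap (M.history k) inferInstance := by
  have : M.history j = (fun h i => h (Fin.castLE (by omega) i)) ∘ M.history k := rfl
  rw [this, ← MeasurableSpace.comap_comp]
  exact MeasurableSpace.comap_mono
    (measurable_pi_lambda _ fun i => measurable_pi_apply _).comap_le

/-- This form lets the independence of the next waiting time and the conditional law of the next
return act on the current wealth. -/
theorem Admissible.exists_tradingWealth_eq_history {M : Market Ω} {P : Measure Ω} {x : ℝ}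
    {α : ℕ → Ω → ℝ} {c : ℝ≥0 → Ω → ℝ} (h : M.Admissible P x α c) (k : ℕ) :
    ∃ f : (Fin (k + 1) → ℝ≥0 × ℝ) → ℝ, Measurable f ∧ M.tradingWealth x α k = f ∘ M.history k := by
  apply Measurable.exists_eq_measurable_comp
  refine Measurable.add (@measurable_const _ _ _ (_) _)
    (Finset.measurable_sum _ fun i hi => Measurable.mul ?_ ?_)
  · obtain ⟨h1, h2⟩ := Finset.mem_Icc.1 hi
    obtain ⟨j, rfl⟩ := Nat.exists_eq_add_of_le' h1
    exact (h.measurable_α j).mono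
      ((M.discreteObs_le_comap_history j).trans (M.comap_history_mono (by omega))) le_rfl
  · obtain ⟨h1, h2⟩ := Finset.mem_Icc.1 hi
    have : M.Z i = (fun h : Fin (k + 1) → ℝ≥0 × ℝ => (h ⟨i, by omega⟩).2) ∘ M.history k := rfl
    rw [this]
    have hm : Measurable fun h : Fin (k + 1) → ℝ≥0 × ℝ => h ⟨i, by omega⟩ := measurable_pi_apply _
    exact hm.snd.comp (comap_measurable _)

theorem measurable_wait (M : Market Ω) (k : ℕ) : Measurable (M.wait k) :=
  (M.measurable_τ (k + 1)).sub (M.measurable_τ k)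

theorem coe_τ_succ (M : Market Ω) (k : ℕ) (ω : Ω) :
    (M.τ (k + 1) ω : ℝ) = M.τ k ω + M.wait k ω := by
  unfold wait
  rw [NNReal.coe_sub (M.τ_strictMono ω (Nat.lt_succ_self k)).le]
  ring

/-- Total consumption up to a trading date is bounded by the wealth obtained by trading alone. -/
theorem Admissible.ae_integral_le_tradingWealth {M : Market Ω} {P : Measure Ω} {x : ℝ}
    {α : ℕ → Ω → ℝ} {c : ℝ≥0 → Ω → ℝ} (h : M.Admissible P x α c) :
    ∀ᵐ ω ∂P, ∀ k, 1 ≤ k → IntervalIntegrable (fun t : ℝ => c t.toNNReal ω) volume 0 (M.τ k ω) ∧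
      ∫ t in (0 : ℝ)..(M.τ k ω : ℝ), c t.toNNReal ω ≤ M.tradingWealth x α k ω := by
  rw [ae_all_iff]
  intro k
  by_cases hk : 1 ≤ k
  · filter_upwards [h.wealth_nonneg k hk] with ω hω _
    refine ⟨hω.1, ?_⟩
    have := hω.2
    unfold wealth at this
    unfold tradingWealth
    linarith
  · exact Eventually.of_forall fun ω h => absurd h hk

theorem Admissible.tradingWealth_nonneg {M : Market Ω} {P : Measure Ω} {x : ℝ} (hx : 0 ≤ x)
    {α : ℕ → Ω → ℝ} {c : ℝ≥0 → Ω → ℝ} (h : M.Admissible P x α c) (k : ℕ) :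
    ∀ᵐ ω ∂P, 0 ≤ M.tradingWealth x α k ω := by
  cases k with
  | zero => exact Eventually.of_forall fun ω => by simpa [tradingWealth] using hx
  | succ k =>
    filter_upwards [h.ae_integral_le_tradingWealth] with ω hω
    exact (intervalIntegral.integral_nonneg (M.τ (k + 1) ω).2
      fun t _ => h.c_nonneg _ _).trans (hω (k + 1) (by omega)).2

end Market

/-! ### Geometric bounds for discounted power moments of wealth. -/

section Growth

variable {Ω : Type*} [MeasurableSpace Ω] {M : Market Ω} {P : Measure Ω} [IsProbabilityMeasure P]
  {lam : ℝ} {p : Kernel ℝ≥0 ℝ} {zlo : ℝ} {zhi : EReal} {k b γ ρ x : ℝ}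
  {α : ℕ → Ω → ℝ} {c : ℝ≥0 → Ω → ℝ}

omit [IsProbabilityMeasure P] in
theorem ObservationAssumptions.lintegral_exp_wait
    (hobs : ObservationAssumptions M P lam p zlo zhi k b) (hρ : 0 < ρ) (n : ℕ) :
    ∫⁻ ω, ENNReal.ofReal (Real.exp (-ρ * M.wait n ω)) ∂P = ENNReal.ofReal (lam / (lam + ρ)) := by
  rw [← lintegral_exp_neg_mul_expMeasure hobs.lam_pos hρ, ← (hobs.wait_law n).map_eq,
    lintegral_map (by fun_prop) (M.measurable_wait n).coe_nnreal_real]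

/-- One step of the growth estimate: the expected `γ`-th power of the wealth after the next trade. -/
theorem lintegral_tradingWealth_succ_le
    (hobs : ObservationAssumptions M P lam p zlo zhi k b) (hγ0 : 0 < γ) (hγ1 : γ < 1)
    (hstat : ∀ s t : ℝ≥0, p s = p t) (hx : 0 ≤ x) (h : M.Admissible P x α c) (n : ℕ)
    {Φ : (Fin (n + 1) → ℝ≥0 × ℝ) → ℝ≥0∞} (hΦ : Measurable Φ) {φ : ℝ≥0 → ℝ≥0∞}
    (hφ : Measurable φ) :
    ∫⁻ ω, Φ (M.history n ω) * φ (M.wait n ω) *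
        ENNReal.ofReal ((M.tradingWealth x α (n + 1) ω) ^ γ) ∂P ≤
      ENNReal.ofReal ((k / zlo) ^ γ) * (∫⁻ ω, φ (M.wait n ω) ∂P) *
        ∫⁻ ω, Φ (M.history n ω) * ENNReal.ofReal ((M.tradingWealth x α n ω) ^ γ) ∂P := by
  have := hobs.markov
  obtain ⟨f, hf, hfα⟩ := h.exists_eq_history n
  obtain ⟨w, hw, hwW⟩ := h.exists_tradingWealth_eq_history n
  have hW : ∀ ω, M.tradingWealth x α (n + 1) ω =
      w (M.history n ω) + f (M.history n ω) * M.Z (n + 1) ω := by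
    intro ω
    rw [M.tradingWealth_succ, hfα, hwW]; rfl
  have hWn : ∀ ω, M.tradingWealth x α n ω = w (M.history n ω) := fun ω => congrFun hwW ω
  have hmX : Measurable fun ω => (M.history n ω, M.wait n ω) :=
    (M.measurable_history n).prodMk (M.measurable_wait n)
  have hmXZ : Measurable fun ω => ((M.history n ω, M.wait n ω), M.Z (n + 1) ω) :=
    hmX.prodMk (M.measurable_Z (n + 1))
  have hlaw : P.map (fun ω => ((M.history n ω, M.wait n ω), M.Z (n + 1) ω)) =
      (P.map fun ω => (M.history n ω, M.wait n ω)) ⊗ₘ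
        Kernel.prodMkLeft (Fin (n + 1) → ℝ≥0 × ℝ) p := (hobs.return_law n).map_eq
  have : IsProbabilityMeasure (P.map fun ω => (M.history n ω, M.wait n ω)) :=
    Measure.isProbabilityMeasure_map hmX.aemeasurable
  -- Nonnegativity of wealth after the trade is disintegrated: for almost every past it holds for
  -- almost every return under the kernel, as Jensen's bound requires.
  have hpos : ∀ᵐ ω ∂P, ∀ᵐ z ∂(p (M.wait n ω)),
      0 ≤ w (M.history n ω) + f (M.history n ω) * z := by
    have hms : MeasurableSet {y : ((Fin (n + 1) → ℝ≥0 × ℝ) × ℝ≥0) × ℝ |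
        0 ≤ w y.1.1 + f y.1.1 * y.2} := measurableSet_le (by fun_prop) (by fun_prop)
    have h1 : ∀ᵐ y ∂(P.map (fun ω => ((M.history n ω, M.wait n ω), M.Z (n + 1) ω))),
        0 ≤ w y.1.1 + f y.1.1 * y.2 := by
      rw [ae_map_iff hmXZ.aemeasurable hms]
      filter_upwards [h.tradingWealth_nonneg hx (n + 1)] with ω hω
      rwa [hW] at hω
    rw [hlaw] at h1
    have h2 := Measure.ae_ae_of_ae_compProd h1
    simpa using ae_of_ae_map hmX.aemeasurable h2
  have hstep : ∫⁻ ω, Φ (M.history n ω) * φ (M.wait n ω) *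
        ENNReal.ofReal ((M.tradingWealth x α (n + 1) ω) ^ γ) ∂P =
      ∫⁻ ω, Φ (M.history n ω) * φ (M.wait n ω) * ∫⁻ z, ENNReal.ofReal
        ((w (M.history n ω) + f (M.history n ω) * z) ^ γ) ∂(p (M.wait n ω)) ∂P := by
    have hmF : Measurable fun y : ((Fin (n + 1) → ℝ≥0 × ℝ) × ℝ≥0) × ℝ => Φ y.1.1 * φ y.1.2 *
        ENNReal.ofReal ((w y.1.1 + f y.1.1 * y.2) ^ γ) := by fun_prop
    have e1 : ∫⁻ ω, Φ (M.history n ω) * φ (M.wait n ω) *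
        ENNReal.ofReal ((M.tradingWealth x α (n + 1) ω) ^ γ) ∂P =
        ∫⁻ y, Φ y.1.1 * φ y.1.2 * ENNReal.ofReal ((w y.1.1 + f y.1.1 * y.2) ^ γ)
          ∂(P.map (fun ω => ((M.history n ω, M.wait n ω), M.Z (n + 1) ω))) := by
      rw [lintegral_map hmF hmXZ]
      simp_rw [hW]
    rw [e1, hlaw, Measure.lintegral_compProd hmF, lintegral_map _ hmX]
    · refine lintegral_congr fun ω => ?_
      simp only [Kernel.prodMkLeft_apply]
      rw [lintegral_const_mul]
      fun_prop
    · exact hmF.lintegral_kernel_prod_right'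
  rw [hstep]
  -- The kernel is constant in time, so the growth bound may be taken at time `0`, where `exp (b *
  -- t) = 1`.
  have hmean : ∀ t, ∫ z, (1 + z) ∂(p t) ≤ k := by
    intro t
    have := hobs.mean_growth 0
    rw [hstat t 0]
    simpa using this
  calc _ ≤ ∫⁻ ω, ENNReal.ofReal ((k / zlo) ^ γ) * ((Φ (M.history n ω) *
            ENNReal.ofReal ((w (M.history n ω)) ^ γ)) * φ (M.wait n ω)) ∂P := by
        refine lintegral_mono_ae ?_
        filter_upwards [hpos] with ω hω
        refine (mul_le_mul_right (lintegral_rpow_affine_le hobs.zlo_pos hobs.zlo_le_one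
          (hobs.neg_zlo_mem_support _) (hobs.integrable _) (hobs.mean_nonneg _) (hmean _) hγ0 hγ1
          hω) _).trans (le_of_eq ?_)
        ring
    _ = _ := by
        have hind := (hobs.wait_indep n).comp
          (φ := fun h => Φ h * ENNReal.ofReal ((w h) ^ γ)) (ψ := φ) (by fun_prop) hφ
        have key := lintegral_mul_eq_lintegral_mul_lintegral_of_indepFun''
          (((by fun_prop : Measurable fun h => Φ h * ENNReal.ofReal ((w h) ^ γ)).comp
            (M.measurable_history n)).aemeasurable)
          (hφ.comp (M.measurable_wait n)).aemeasurable hind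
        simp only [Function.comp_apply] at key
        rw [lintegral_const_mul _ (by
          have h1 := M.measurable_history n
          have h2 := M.measurable_wait n
          fun_prop), key]
        simp only [hWn]
        ring

theorem measurable_exp_last (ρ : ℝ) (n : ℕ) : Measurable fun h : Fin (n + 1) → ℝ≥0 × ℝ =>
    ENNReal.ofReal (Real.exp (-ρ * (h (Fin.last n)).1)) := by
  have hm : Measurable fun h : Fin (n + 1) → ℝ≥0 × ℝ => h (Fin.last n) := measurable_pi_apply _
  have := hm.fst.coe_nnreal_real
  fun_prop

theorem exp_τ_succ (M : Market Ω) (ρ : ℝ) (n : ℕ) (ω : Ω) :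
    ENNReal.ofReal (Real.exp (-ρ * M.τ (n + 1) ω)) =
      ENNReal.ofReal (Real.exp (-ρ * M.τ n ω)) * ENNReal.ofReal (Real.exp (-ρ * M.wait n ω)) := by
  rw [M.coe_τ_succ, ← ENNReal.ofReal_mul (Real.exp_pos _).le, ← Real.exp_add]
  ring_nf

theorem ObservationAssumptions.lintegral_exp_τ
    (hobs : ObservationAssumptions M P lam p zlo zhi k b) (hρ : 0 < ρ) (n : ℕ) :
    ∫⁻ ω, ENNReal.ofReal (Real.exp (-ρ * M.τ n ω)) ∂P = ENNReal.ofReal (lam / (lam + ρ)) ^ n := by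
  induction n with
  | zero => simp [M.τ_zero]
  | succ n ih =>
    have hind := (hobs.wait_indep n).comp (measurable_exp_last ρ n)
      (by fun_prop : Measurable fun t : ℝ≥0 => ENNReal.ofReal (Real.exp (-ρ * t)))
    simp_rw [exp_τ_succ]
    rw [pow_succ, ← ih, ← hobs.lintegral_exp_wait hρ n]
    refine lintegral_mul_eq_lintegral_mul_lintegral_of_indepFun'' ?_ ?_ hind
    · exact ((measurable_exp_last ρ n).comp (M.measurable_history n)).aemeasurable
    · have := M.measurable_wait n
      fun_prop

/-- Each period costs a factor `(k / zlo)^γ` for the return and `λ / (λ + ρ)` for the discounted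
waiting time. -/
theorem lintegral_exp_mul_tradingWealth_le
    (hobs : ObservationAssumptions M P lam p zlo zhi k b) (hγ0 : 0 < γ) (hγ1 : γ < 1) (hρ : 0 < ρ)
    (hstat : ∀ s t : ℝ≥0, p s = p t) (hx : 0 ≤ x) (h : M.Admissible P x α c) (n : ℕ) :
    ∫⁻ ω, ENNReal.ofReal (Real.exp (-ρ * M.τ n ω)) *
        ENNReal.ofReal ((M.tradingWealth x α n ω) ^ γ) ∂P ≤
      (ENNReal.ofReal ((k / zlo) ^ γ) * ENNReal.ofReal (lam / (lam + ρ))) ^ n *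
        ENNReal.ofReal (x ^ γ) := by
  induction n with
  | zero => simp [M.τ_zero, Market.tradingWealth]
  | succ n ih =>
    have := lintegral_tradingWealth_succ_le hobs hγ0 hγ1 hstat hx h n (measurable_exp_last ρ n)
      (by fun_prop : Measurable fun t : ℝ≥0 => ENNReal.ofReal (Real.exp (-ρ * t)))
    simp_rw [exp_τ_succ]
    refine this.trans ?_
    rw [hobs.lintegral_exp_wait hρ n, pow_succ', mul_assoc (_ * _)]
    exact mul_le_mul_right ih _

end Growth

/-! ### Finiteness and growth of the value function. -/

theorem UtilityAssumptions.nonneg {U : ℝ → ℝ} {γ K₁ : ℝ} (hU : UtilityAssumptions U γ K₁) {x : ℝ}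
    (hx : 0 ≤ x) : 0 ≤ U x := by
  rw [← hU.zero]
  exact hU.strictMono.monotoneOn self_mem_Ici hx hx

theorem rpow_le_one_add {y γ : ℝ} (hy : 0 ≤ y) (hγ0 : 0 < γ) (hγ1 : γ < 1) : y ^ γ ≤ 1 + y := by
  rcases le_total y 1 with h | h
  · linarith [Real.rpow_le_one hy h hγ0.le]
  · calc y ^ γ ≤ y ^ (1 : ℝ) := Real.rpow_le_rpow_of_exponent_le h hγ1.le
      _ ≤ 1 + y := by rw [Real.rpow_one]; linarith

theorem lintegral_exp_neg_mul_Ioi {ρ : ℝ} (hρ : 0 < ρ) (s : ℝ) :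
    ∫⁻ t in Ioi s, ENNReal.ofReal (Real.exp (-ρ * t)) = ENNReal.ofReal (Real.exp (-ρ * s) / ρ) := by
  rw [← ofReal_integral_eq_lintegral_ofReal (integrableOn_exp_mul_Ioi (by linarith) s)
    (Eventually.of_forall fun _ => (Real.exp_pos _).le), integral_exp_mul_Ioi (by linarith)]
  congr 1
  rw [neg_div_neg_eq]

/-- Discounted utility of a consumption plan over a period, given a bound on total consumption. -/
theorem UtilityAssumptions.lintegral_Ioc_le {U : ℝ → ℝ} {γ K₁ : ℝ} (hU : UtilityAssumptions U γ K₁)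
    {ρ : ℝ} (hρ : 0 < ρ) {c : ℝ → ℝ} (hc : ∀ t, 0 ≤ c t) {s T W : ℝ} (hsT : s ≤ T)
    (hci : IntervalIntegrable c volume s T) (hW : ∫ t in s..T, c t ≤ W) :
    ∫⁻ t in Ioc s T, ENNReal.ofReal (Real.exp (-ρ * t) * U (c t)) ≤
      ENNReal.ofReal (K₁ * (1 / ρ + 1)) * ENNReal.ofReal (Real.exp (-ρ * s)) *
        (ENNReal.ofReal (W ^ γ) + 1) := by
  have hγ0 := hU.γ_pos
  have hγ1 := hU.γ_lt_one
  have hK := hU.K₁_pos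
  have hW0 : 0 ≤ W := (intervalIntegral.integral_nonneg hsT fun t _ => hc t).trans hW
  -- A reference level that is positive even when `W = 0`. The power bound on `U` becomes affine in
  -- `y / m`, hence integrable against total consumption.
  set m := W + 1 with hm
  have hm0 : 0 < m := by linarith
  have hmγ : 0 < m ^ γ := Real.rpow_pos_of_pos hm0 _
  have hpt : ∀ y, 0 ≤ y → U y ≤ K₁ * m ^ γ * (1 + y / m) := by
    intro y hy
    have h1 := rpow_le_one_add (div_nonneg hy hm0.le) hγ0 hγ1
    rw [Real.div_rpow hy hm0.le, div_le_iff₀ hmγ] at h1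
    nlinarith [hU.growth y hy]
  have hle : ∀ t ∈ Ioc s T, ENNReal.ofReal (Real.exp (-ρ * t) * U (c t)) ≤
      ENNReal.ofReal (K₁ * m ^ γ) * ENNReal.ofReal (Real.exp (-ρ * t)) +
        ENNReal.ofReal (K₁ * m ^ γ * Real.exp (-ρ * s) / m) * ENNReal.ofReal (c t) := by
    intro t ht
    rw [← ENNReal.ofReal_mul (by positivity), ← ENNReal.ofReal_mul (by positivity),
      ← ENNReal.ofReal_add (by positivity) (mul_nonneg (by positivity) (hc t))]
    apply ENNReal.ofReal_le_ofReal
    have h1 := mul_le_mul_of_nonneg_left (hpt (c t) (hc t)) (Real.exp_pos (-ρ * t)).le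
    have h2 : Real.exp (-ρ * t) ≤ Real.exp (-ρ * s) :=
      Real.exp_le_exp.2 (by nlinarith [ht.1])
    have h3 : 0 ≤ K₁ * m ^ γ * (c t / m) :=
      mul_nonneg (by positivity) (div_nonneg (hc t) hm0.le)
    calc _ ≤ _ := h1
      _ = K₁ * m ^ γ * Real.exp (-ρ * t) + K₁ * m ^ γ * (c t / m) * Real.exp (-ρ * t) := by ring
      _ ≤ K₁ * m ^ γ * Real.exp (-ρ * t) + K₁ * m ^ γ * (c t / m) * Real.exp (-ρ * s) := by
        gcongr
      _ = _ := by ring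
  calc _ ≤ ∫⁻ t in Ioc s T, (ENNReal.ofReal (K₁ * m ^ γ) * ENNReal.ofReal (Real.exp (-ρ * t)) +
        ENNReal.ofReal (K₁ * m ^ γ * Real.exp (-ρ * s) / m) * ENNReal.ofReal (c t)) :=
        setLIntegral_mono' measurableSet_Ioc hle
    _ = ENNReal.ofReal (K₁ * m ^ γ) * (∫⁻ t in Ioc s T, ENNReal.ofReal (Real.exp (-ρ * t))) +
        ENNReal.ofReal (K₁ * m ^ γ * Real.exp (-ρ * s) / m) *
          ∫⁻ t in Ioc s T, ENNReal.ofReal (c t) := by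
        rw [lintegral_add_left (by fun_prop), lintegral_const_mul _ (by fun_prop),
          lintegral_const_mul' _ _ ENNReal.ofReal_ne_top]
    _ ≤ ENNReal.ofReal (K₁ * m ^ γ) * ENNReal.ofReal (Real.exp (-ρ * s) / ρ) +
        ENNReal.ofReal (K₁ * m ^ γ * Real.exp (-ρ * s) / m) * ENNReal.ofReal W := by
        gcongr
        · exact (lintegral_mono_set Ioc_subset_Ioi_self).trans (lintegral_exp_neg_mul_Ioi hρ s).le
        · rw [← ofReal_integral_eq_lintegral_ofReal hci.1 (Eventually.of_forall fun t => hc t),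
            ← intervalIntegral.integral_of_le hsT]
          exact ENNReal.ofReal_le_ofReal hW
    _ ≤ ENNReal.ofReal (K₁ * (1 / ρ + 1) * Real.exp (-ρ * s) * (W ^ γ + 1)) := by
        rw [← ENNReal.ofReal_mul (by positivity), ← ENNReal.ofReal_mul (by positivity),
          ← ENNReal.ofReal_add (by positivity) (by positivity)]
        apply ENNReal.ofReal_le_ofReal
        have h1 : m ^ γ ≤ W ^ γ + 1 := by
          simpa using Real.rpow_add_le_add_rpow hW0 zero_le_one hγ0.le hγ1.le
        have h2 : W / m ≤ 1 := (div_le_one hm0).2 (by linarith)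
        calc _ = K₁ * Real.exp (-ρ * s) * m ^ γ * (1 / ρ + W / m) := by ring
          _ ≤ K₁ * Real.exp (-ρ * s) * (W ^ γ + 1) * (1 / ρ + 1) := by gcongr
          _ = _ := by ring
    _ = _ := by
        rw [ENNReal.ofReal_mul (by positivity), ENNReal.ofReal_mul (by positivity),
          ENNReal.ofReal_add (by positivity) zero_le_one, ENNReal.ofReal_one]

section Value

variable {Ω : Type*} [MeasurableSpace Ω] {M : Market Ω} {P : Measure Ω} [IsProbabilityMeasure P]
  {lam : ℝ} {p : Kernel ℝ≥0 ℝ} {zlo : ℝ} {zhi : EReal} {k b γ ρ x : ℝ}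
  {U : ℝ → ℝ} {K₁ : ℝ}

/-- The expectations of `e^{-ρ τ_n}` form a convergent geometric series, so almost surely `e^{-ρ
τ_n} → 0`. -/
theorem ObservationAssumptions.ae_tendsto_τ
    (hobs : ObservationAssumptions M P lam p zlo zhi k b) (hρ : 0 < ρ) :
    ∀ᵐ ω ∂P, Tendsto (fun n => (M.τ n ω : ℝ)) atTop atTop := by
  have hlam := hobs.lam_pos
  have hm : ∀ n, Measurable fun ω => ENNReal.ofReal (Real.exp (-ρ * M.τ n ω)) := by
    intro n
    have := M.measurable_τ n
    fun_prop
  have hfin : ∫⁻ ω, ∑' n, ENNReal.ofReal (Real.exp (-ρ * M.τ n ω)) ∂P ≠ ⊤ := by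
    rw [lintegral_tsum fun n => (hm n).aemeasurable]
    simp_rw [hobs.lintegral_exp_τ hρ]
    rw [ENNReal.tsum_geometric, ENNReal.inv_ne_top]
    refine (tsub_pos_of_lt ?_).ne'
    rw [← ENNReal.ofReal_one]
    exact (ENNReal.ofReal_lt_ofReal_iff one_pos).2 ((div_lt_one (by positivity)).2 (by linarith))
  filter_upwards [ae_lt_top (Measurable.tsum hm) hfin] with ω hω
  have h1 := ENNReal.tendsto_atTop_zero_of_tsum_ne_top hω.ne
  have h2 : Tendsto (fun n => Real.exp (-ρ * M.τ n ω)) atTop (𝓝 0) := by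
    have := (ENNReal.tendsto_toReal ENNReal.zero_ne_top).comp h1
    refine this.congr fun n => ?_
    simp [ENNReal.toReal_ofReal (Real.exp_pos _).le]
  have h3 : Tendsto (fun n => -(-ρ * (M.τ n ω : ℝ))) atTop atTop :=
    tendsto_neg_atBot_atTop.comp (Real.tendsto_exp_comp_nhds_zero.1 h2)
  refine (h3.const_mul_atTop (inv_pos.2 hρ)).congr fun n => ?_
  field_simp

/-- Time is cut at the trading dates. In each period, consumption is at most the trading wealth at
the end of the period, and discounting is at least that of its start; the two geometric series are
then summed. -/
theorem lintegral_utility_le (hU : UtilityAssumptions U γ K₁)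
    (hobs : ObservationAssumptions M P lam p zlo zhi k b) (hρ : 0 < ρ)
    (hstat : ∀ s t : ℝ≥0, p s = p t) (hx : 0 ≤ x) {α : ℕ → Ω → ℝ} {c : ℝ≥0 → Ω → ℝ}
    (h : M.Admissible P x α c) :
    ∫⁻ ω, (∫⁻ t in Ioi (0 : ℝ), ENNReal.ofReal (Real.exp (-ρ * t) * U (c t.toNNReal ω))) ∂P ≤
      ENNReal.ofReal (K₁ * (1 / ρ + 1)) *
        (ENNReal.ofReal ((k / zlo) ^ γ) *
          (1 - ENNReal.ofReal ((k / zlo) ^ γ) * ENNReal.ofReal (lam / (lam + ρ)))⁻¹ *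
            ENNReal.ofReal (x ^ γ) + (1 - ENNReal.ofReal (lam / (lam + ρ)))⁻¹) := by
  set β := ENNReal.ofReal ((k / zlo) ^ γ)
  set r := ENNReal.ofReal (lam / (lam + ρ)) with hr
  set K := ENNReal.ofReal (K₁ * (1 / ρ + 1))
  have hmW : ∀ n, Measurable (M.tradingWealth x α n) := by
    intro n
    obtain ⟨f, hf, hfe⟩ := h.exists_tradingWealth_eq_history n
    rw [hfe]
    exact hf.comp (M.measurable_history n)
  have hmτ := M.measurable_τ
  have hpath : ∀ᵐ ω ∂P,
      ∫⁻ t in Ioi (0 : ℝ), ENNReal.ofReal (Real.exp (-ρ * t) * U (c t.toNNReal ω)) ≤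
      ∑' n, K * ENNReal.ofReal (Real.exp (-ρ * M.τ n ω)) *
        (ENNReal.ofReal ((M.tradingWealth x α (n + 1) ω) ^ γ) + 1) := by
    filter_upwards [hobs.ae_tendsto_τ hρ, h.ae_integral_le_tradingWealth] with ω hω hW
    have hmono : StrictMono fun n => (M.τ n ω : ℝ) := fun i j hij => by
      exact_mod_cast M.τ_strictMono ω hij
    have hsub : Ioi (0 : ℝ) ⊆ ⋃ n, Ioc (M.τ n ω : ℝ) (M.τ (n + 1) ω) := by
      intro t ht
      have hex : ∃ n, t ≤ M.τ n ω := (hω.eventually_ge_atTop t).exists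
      classical
      obtain ⟨j, hj⟩ : ∃ j, Nat.find hex = j + 1 := by
        refine Nat.exists_eq_succ_of_ne_zero fun h0 => ?_
        have := Nat.find_spec hex
        rw [h0, M.τ_zero] at this
        exact absurd ht (not_lt.2 (by simpa using this))
      refine mem_iUnion.2 ⟨j, not_le.1 (Nat.find_min hex (by omega)), ?_⟩
      have := Nat.find_spec hex
      rwa [hj] at this
    refine (lintegral_mono_set hsub).trans ((lintegral_iUnion_le _ _).trans ?_)
    refine ENNReal.tsum_le_tsum fun n => ?_
    obtain ⟨hi, hle⟩ := hW (n + 1) (by omega)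
    have hτ : (M.τ n ω : ℝ) ≤ M.τ (n + 1) ω := (hmono (Nat.lt_succ_self n)).le
    have hi0 : IntervalIntegrable (fun t : ℝ => c t.toNNReal ω) volume 0 (M.τ n ω) :=
      hi.mono_set (by
        rw [uIcc_of_le (NNReal.coe_nonneg _), uIcc_of_le (NNReal.coe_nonneg _)]
        exact Icc_subset_Icc_right hτ)
    have hi1 : IntervalIntegrable (fun t : ℝ => c t.toNNReal ω) volume (M.τ n ω) (M.τ (n + 1) ω) :=
      hi0.symm.trans hi
    refine hU.lintegral_Ioc_le hρ (fun t => h.c_nonneg _ _) hτ hi1 ?_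
    have := intervalIntegral.integral_add_adjacent_intervals hi0 hi1
    have h0 : 0 ≤ ∫ t in (0 : ℝ)..(M.τ n ω : ℝ), c t.toNNReal ω :=
      intervalIntegral.integral_nonneg (M.τ n ω).2 fun t _ => h.c_nonneg _ _
    linarith
  refine (lintegral_mono_ae hpath).trans ?_
  rw [lintegral_tsum fun n => by fun_prop]
  have hn : ∀ n, ∫⁻ ω, K * ENNReal.ofReal (Real.exp (-ρ * M.τ n ω)) *
        (ENNReal.ofReal ((M.tradingWealth x α (n + 1) ω) ^ γ) + 1) ∂P ≤
      K * (β * (β * r) ^ n * ENNReal.ofReal (x ^ γ) + r ^ n) := by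
    intro n
    -- The wealth is that of `τ (n + 1)` but the discount only that of `τ n`, so the waiting time
    -- gets weight `1` and one factor `β` stays undiscounted.
    have h1 := lintegral_tradingWealth_succ_le hobs hU.γ_pos hU.γ_lt_one hstat hx h n
      (measurable_exp_last ρ n) (measurable_const (a := (1 : ℝ≥0∞)))
    have h2 := lintegral_exp_mul_tradingWealth_le hobs hU.γ_pos hU.γ_lt_one hρ hstat hx h n
    simp only [mul_one, lintegral_const, measure_univ] at h1
    calc _ = K * (∫⁻ ω, ENNReal.ofReal (Real.exp (-ρ * M.τ n ω)) *
            ENNReal.ofReal ((M.tradingWealth x α (n + 1) ω) ^ γ) ∂P +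
            ∫⁻ ω, ENNReal.ofReal (Real.exp (-ρ * M.τ n ω)) ∂P) := by
          rw [← lintegral_add_left (by fun_prop), ← lintegral_const_mul _ (by fun_prop)]
          refine lintegral_congr fun ω => ?_
          ring
      _ ≤ K * (β * ((β * r) ^ n * ENNReal.ofReal (x ^ γ)) + r ^ n) := by
          gcongr
          · exact h1.trans (mul_le_mul_right h2 _)
          · exact (hobs.lintegral_exp_τ hρ n).le
      _ = _ := by ring
  refine (ENNReal.tsum_le_tsum hn).trans (le_of_eq ?_)
  rw [ENNReal.tsum_mul_left, ENNReal.tsum_add, ENNReal.tsum_mul_right, ENNReal.tsum_mul_left,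
    ENNReal.tsum_geometric, ENNReal.tsum_geometric]

/-- The value function has at most the growth of `x ^ γ`. -/
theorem exists_value_le (hU : UtilityAssumptions U γ K₁)
    (hobs : ObservationAssumptions M P lam p zlo zhi k b) (hρ : 0 < ρ)
    (hgrowth : b * γ + lam * (k ^ γ / zlo ^ γ - 1) < ρ) (hstat : ∀ s t : ℝ≥0, p s = p t) :
    ∃ C : ℝ≥0∞, C ≠ ⊤ ∧ ∀ x, 0 ≤ x → M.value P U ρ x ≤ C * (1 + ENNReal.ofReal (x ^ γ)) := by
  have hlam := hobs.lam_pos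
  have hzlo := hobs.zlo_pos
  have hk := hobs.k_nonneg
  set β := ENNReal.ofReal ((k / zlo) ^ γ) with hβ
  set r := ENNReal.ofReal (lam / (lam + ρ)) with hr
  have hr1 : r < 1 := by
    rw [hr, ← ENNReal.ofReal_one]
    exact (ENNReal.ofReal_lt_ofReal_iff one_pos).2 ((div_lt_one (by positivity)).2 (by linarith))
  -- Up to the nonnegative term `b * γ`, this is the assumed lower bound on `ρ`.
  have hβr : β * r < 1 := by
    rw [hβ, hr, ← ENNReal.ofReal_mul (by positivity), ← ENNReal.ofReal_one]
    refine (ENNReal.ofReal_lt_ofReal_iff one_pos).2 ?_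
    rw [← mul_div_assoc, div_lt_one (by positivity), Real.div_rpow hk hzlo.le]
    nlinarith [mul_nonneg hobs.b_nonneg hU.γ_pos.le]
  have hf1 : (1 - β * r)⁻¹ ≠ ⊤ := ENNReal.inv_ne_top.2 (tsub_pos_of_lt hβr).ne'
  have hf2 : (1 - r)⁻¹ ≠ ⊤ := ENNReal.inv_ne_top.2 (tsub_pos_of_lt hr1).ne'
  have hf3 : β * (1 - β * r)⁻¹ ≠ ⊤ := ENNReal.mul_ne_top ENNReal.ofReal_ne_top hf1
  refine ⟨ENNReal.ofReal (K₁ * (1 / ρ + 1)) * (β * (1 - β * r)⁻¹ + (1 - r)⁻¹),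
    ENNReal.mul_ne_top ENNReal.ofReal_ne_top (ENNReal.add_ne_top.2 ⟨hf3, hf2⟩), fun x hx => ?_⟩
  unfold Market.value
  refine iSup_le fun α => iSup_le fun c => iSup_le fun h => ?_
  refine (lintegral_utility_le hU hobs hρ hstat hx h).trans ?_
  rw [mul_assoc (ENNReal.ofReal (K₁ * (1 / ρ + 1)))]
  refine mul_le_mul_right ?_ _
  rw [add_mul, mul_add, mul_add, mul_one, mul_one]
  exact add_le_add le_add_self le_self_add

end Value

/-! ### Monotonicity and concavity of the value function. -/

section Value

variable {Ω : Type*} [MeasurableSpace Ω] {M : Market Ω} {P : Measure Ω}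

theorem Market.Admissible.convexCombination {x x' θ θ' : ℝ} (hθ : 0 ≤ θ) (hθ' : 0 ≤ θ')
    {α α' : ℕ → Ω → ℝ} {c c' : ℝ≥0 → Ω → ℝ} (h : M.Admissible P x α c)
    (h' : M.Admissible P x' α' c') :
    M.Admissible P (θ * x + θ' * x') (fun k ω => θ * α k ω + θ' * α' k ω)
      (fun t ω => θ * c t ω + θ' * c' t ω) where
  measurable_α k := ((h.measurable_α k).const_mul θ).add ((h'.measurable_α k).const_mul θ')
  predictable_c :=
    (StronglyMeasurable.const_mul h.predictable_c θ).add
      (StronglyMeasurable.const_mul h'.predictable_c θ')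
  c_nonneg t ω :=
    add_nonneg (mul_nonneg hθ (h.c_nonneg t ω)) (mul_nonneg hθ' (h'.c_nonneg t ω))
  wealth_nonneg k hk := by
    filter_upwards [h.wealth_nonneg k hk, h'.wealth_nonneg k hk] with ω h1 h2
    refine ⟨(h1.1.const_mul θ).add (h2.1.const_mul θ'), ?_⟩
    have hw : M.wealth (θ * x + θ' * x') (fun k ω => θ * α k ω + θ' * α' k ω)
        (fun t ω => θ * c t ω + θ' * c' t ω) k ω =
        θ * M.wealth x α c k ω + θ' * M.wealth x' α' c' k ω := by
      unfold Market.wealth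
      rw [intervalIntegral.integral_add (h1.1.const_mul θ) (h2.1.const_mul θ'),
        intervalIntegral.integral_const_mul, intervalIntegral.integral_const_mul]
      have : ∑ i ∈ Finset.Icc 1 k, (θ * α i ω + θ' * α' i ω) * M.Z i ω =
          θ * ∑ i ∈ Finset.Icc 1 k, α i ω * M.Z i ω +
            θ' * ∑ i ∈ Finset.Icc 1 k, α' i ω * M.Z i ω := by
        rw [Finset.mul_sum, Finset.mul_sum, ← Finset.sum_add_distrib]
        exact Finset.sum_congr rfl fun i _ => by ring
      rw [this]
      ring
    rw [hw]
    exact add_nonneg (mul_nonneg hθ h1.2) (mul_nonneg hθ' h2.2)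

theorem Market.Admissible.mono {x x' : ℝ} (hx : x ≤ x') {α : ℕ → Ω → ℝ} {c : ℝ≥0 → Ω → ℝ}
    (h : M.Admissible P x α c) : M.Admissible P x' α c where
  measurable_α := h.measurable_α
  predictable_c := h.predictable_c
  c_nonneg := h.c_nonneg
  wealth_nonneg k hk := by
    filter_upwards [h.wealth_nonneg k hk] with ω h1
    refine ⟨h1.1, h1.2.trans ?_⟩
    unfold Market.wealth
    linarith

theorem Market.value_mono {U : ℝ → ℝ} {ρ : ℝ} : Monotone (M.value P U ρ) := fun _ _ hx =>
  iSup_mono fun _ => iSup_mono fun _ => iSup_mono' fun h => ⟨h.mono hx, le_rfl⟩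

theorem Market.admissible_zero {x : ℝ} (hx : 0 ≤ x) :
    M.Admissible P x (fun _ _ => 0) (fun _ _ => 0) where
  measurable_α _ := measurable_const
  predictable_c := stronglyMeasurable_const
  c_nonneg _ _ := le_rfl
  wealth_nonneg k _ := Eventually.of_forall fun ω => by
    simpa [Market.wealth] using hx

/-- Wealth is linear in `(x, α, c)`, so mixing two admissible policies is admissible, and `U` is
concave. -/
theorem Market.value_concave {U : ℝ → ℝ} {γ K₁ : ℝ} (hU : UtilityAssumptions U γ K₁) {ρ : ℝ}
    {x x' θ θ' : ℝ} (hx : 0 ≤ x) (hx' : 0 ≤ x') (hθ : 0 ≤ θ) (hθ' : 0 ≤ θ') (hsum : θ + θ' = 1) :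
    ENNReal.ofReal θ * M.value P U ρ x + ENNReal.ofReal θ' * M.value P U ρ x' ≤
      M.value P U ρ (θ * x + θ' * x') := by
  have hval : ∀ x, M.value P U ρ x = ⨆ q : (ℕ → Ω → ℝ) × (ℝ≥0 → Ω → ℝ),
      ⨆ (_ : M.Admissible P x q.1 q.2), ∫⁻ ω, (∫⁻ t in Ioi (0 : ℝ),
        ENNReal.ofReal (Real.exp (-ρ * t) * U (q.2 t.toNNReal ω))) ∂P := by
    intro x
    rw [Market.value, iSup_prod]
  rw [hval x, hval x']
  simp_rw [ENNReal.mul_iSup]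
  refine ENNReal.biSup_add_biSup_le'
    (p := fun q : (ℕ → Ω → ℝ) × (ℝ≥0 → Ω → ℝ) => M.Admissible P x q.1 q.2)
    (q := fun q : (ℕ → Ω → ℝ) × (ℝ≥0 → Ω → ℝ) => M.Admissible P x' q.1 q.2)
    ⟨(_, _), Market.admissible_zero hx⟩ ⟨(_, _), Market.admissible_zero hx'⟩ ?_
  rintro ⟨α, c⟩ h ⟨α', c'⟩ h'
  refine le_trans ?_ (le_iSup_of_le _ (le_iSup_of_le _ (le_iSup_of_le
    (h.convexCombination hθ hθ' h') le_rfl)))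
  rw [← lintegral_const_mul' _ _ ENNReal.ofReal_ne_top,
    ← lintegral_const_mul' _ _ ENNReal.ofReal_ne_top]
  -- Superadditivity of the lower integral suffices, and it needs no measurability of the
  -- integrands.
  refine (le_lintegral_add _ _).trans (lintegral_mono fun ω => ?_)
  rw [← lintegral_const_mul' _ _ ENNReal.ofReal_ne_top,
    ← lintegral_const_mul' _ _ ENNReal.ofReal_ne_top]
  refine (le_lintegral_add _ _).trans (lintegral_mono fun t => ?_)
  have h1 := h.c_nonneg t.toNNReal ω
  have h2 := h'.c_nonneg t.toNNReal ω
  have he := (Real.exp_pos (-ρ * t)).le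
  simp only
  rw [← ENNReal.ofReal_mul hθ, ← ENNReal.ofReal_mul hθ',
    ← ENNReal.ofReal_add (mul_nonneg hθ (mul_nonneg he (hU.nonneg h1)))
      (mul_nonneg hθ' (mul_nonneg he (hU.nonneg h2)))]
  apply ENNReal.ofReal_le_ofReal
  have := hU.strictConcave.concaveOn.2 h1 h2 hθ hθ' hsum
  simp only [smul_eq_mul] at this
  nlinarith [mul_le_mul_of_nonneg_left this he]

end Value

/-! ### The reward `gFun`: finite, monotone, concave. -/

section Bequest

variable {Ω : Type*} [MeasurableSpace Ω] {M : Market Ω} {P : Measure Ω}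
  {lam : ℝ} {p : Kernel ℝ≥0 ℝ} {zlo : ℝ} {zhi : EReal} {k b γ ρ : ℝ} {U : ℝ → ℝ} {K₁ : ℝ}

theorem gFun_eq_of_stationary (hstat : ∀ s t : ℝ≥0, p s = p t) (s t x a : ℝ) :
    gFun M P U ρ lam p s x a = gFun M P U ρ lam p t x a := by
  unfold gFun
  rw [hstat s.toNNReal t.toNNReal]

theorem gFun_mono {t a : ℝ} : Monotone fun x => gFun M P U ρ lam p t x a := fun _ _ hx =>
  mul_le_mul_right (lintegral_mono fun _ => Market.value_mono (by linarith)) _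

/-- For `x ≥ l(a)` the wealth after the trade is almost surely nonnegative, where the value function
is bounded by an affine function of an integrable return. -/
theorem gFun_ne_top [IsProbabilityMeasure P] (hU : UtilityAssumptions U γ K₁)
    (hobs : ObservationAssumptions M P lam p zlo zhi k b) (hρ : 0 < ρ)
    (hgrowth : b * γ + lam * (k ^ γ / zlo ^ γ - 1) < ρ) (hstat : ∀ s t : ℝ≥0, p s = p t)
    {a : ℝ} (ha : a ∈ investSet zhi) {x : ℝ} (hx : minWealth zlo zhi a ≤ x) (t : ℝ) :
    gFun M P U ρ lam p t x a ≠ ⊤ := by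
  have := hobs.markov
  obtain ⟨C, hC, hle⟩ := exists_value_le hU hobs hρ hgrowth hstat
  refine ENNReal.mul_ne_top ENNReal.ofReal_ne_top (ne_top_of_le_ne_top ?_ (lintegral_mono_ae
    (g := fun z => C * (1 + ENNReal.ofReal (1 + (x + a * z)))) ?_))
  · rw [lintegral_const_mul' _ _ hC, lintegral_add_left (by fun_prop)]
    refine ENNReal.mul_ne_top hC (ENNReal.add_ne_top.2 ⟨by simp, ?_⟩)
    exact ((integrable_const (1 : ℝ)).add ((integrable_const x).add
      ((hobs.integrable t.toNNReal).const_mul a))).lintegral_lt_top.ne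
  · filter_upwards [hobs.ae_minWealth_add_nonneg t.toNNReal ha] with z hz
    have hz' : 0 ≤ x + a * z := by linarith
    refine (hle _ hz').trans (mul_le_mul_right (add_le_add le_rfl ?_) _)
    exact ENNReal.ofReal_le_ofReal (rpow_le_one_add hz' hU.γ_pos hU.γ_lt_one)

theorem gFun_concave (hU : UtilityAssumptions U γ K₁)
    (hobs : ObservationAssumptions M P lam p zlo zhi k b) {a : ℝ} (ha : a ∈ investSet zhi) (t : ℝ)
    {x x' θ θ' : ℝ} (hx : minWealth zlo zhi a ≤ x) (hx' : minWealth zlo zhi a ≤ x') (hθ : 0 ≤ θ)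
    (hθ' : 0 ≤ θ') (hsum : θ + θ' = 1) :
    ENNReal.ofReal θ * gFun M P U ρ lam p t x a + ENNReal.ofReal θ' * gFun M P U ρ lam p t x' a ≤
      gFun M P U ρ lam p t (θ * x + θ' * x') a := by
  unfold gFun
  rw [mul_left_comm, mul_left_comm (ENNReal.ofReal θ'), ← mul_add]
  refine mul_le_mul_right ?_ _
  rw [← lintegral_const_mul' _ _ ENNReal.ofReal_ne_top,
    ← lintegral_const_mul' _ _ ENNReal.ofReal_ne_top]
  refine (le_lintegral_add _ _).trans (lintegral_mono_ae ?_)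
  filter_upwards [hobs.ae_minWealth_add_nonneg t.toNNReal ha] with z hz
  have := Market.value_concave (M := M) (P := P) (ρ := ρ) hU (by linarith : 0 ≤ x + a * z)
    (by linarith : 0 ≤ x' + a * z) hθ hθ' hsum
  refine this.trans (le_of_eq ?_)
  congr 1
  linear_combination (a * z) * hsum

end Bequest

/-! ### Tangents and the Legendre-type function of the utility. -/

namespace UtilityAssumptions

variable {U : ℝ → ℝ} {γ K₁ : ℝ}

theorem differentiableAt (hU : UtilityAssumptions U γ K₁) {c : ℝ} (hc : 0 < c) :
    DifferentiableAt ℝ U c :=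
  (hU.contDiff.differentiableOn one_ne_zero).differentiableAt (Ioi_mem_nhds hc)

theorem continuousOn_deriv (hU : UtilityAssumptions U γ K₁) : ContinuousOn (deriv U) (Ioi 0) :=
  hU.contDiff.continuousOn_deriv_of_isOpen isOpen_Ioi le_rfl

theorem strictAntiOn_deriv (hU : UtilityAssumptions U γ K₁) : StrictAntiOn (deriv U) (Ioi 0) :=
  (hU.strictConcave.subset Ioi_subset_Ici_self (convex_Ioi 0)).strictAntiOn_deriv
    fun _ hc => hU.differentiableAt hc

theorem lt_tangent (hU : UtilityAssumptions U γ K₁) {c z : ℝ} (hc : 0 < c) (hz : 0 ≤ z)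
    (hne : z ≠ c) : U z < U c + deriv U c * (z - c) := by
  rcases lt_or_gt_of_ne hne with h | h
  · have := hU.strictConcave.deriv_lt_slope hz hc.le h (hU.differentiableAt hc)
    rw [slope_def_field, lt_div_iff₀ (by linarith)] at this
    linarith
  · have := hU.strictConcave.slope_lt_deriv hc.le hz h (hU.differentiableAt hc)
    rw [slope_def_field, div_lt_iff₀ (by linarith)] at this
    linarith

theorem le_tangent (hU : UtilityAssumptions U γ K₁) {c z : ℝ} (hc : 0 < c) (hz : 0 ≤ z) :
    U z ≤ U c + deriv U c * (z - c) := by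
  rcases eq_or_ne z c with rfl | h
  · simp
  · exact (hU.lt_tangent hc hz h).le

theorem deriv_pos (hU : UtilityAssumptions U γ K₁) {c : ℝ} (hc : 0 < c) : 0 < deriv U c := by
  have h1 := hU.le_tangent hc (by linarith : 0 ≤ c + 1)
  have h2 := hU.strictMono hc.le (by simp only [mem_Ici]; linarith : c + 1 ∈ Ici 0)
    (by linarith : c < c + 1)
  linarith

theorem exists_deriv_eq (hU : UtilityAssumptions U γ K₁) {q : ℝ} (hq : 0 < q) :
    ∃ c, 0 < c ∧ deriv U c = q := by
  obtain ⟨c₁, h1, hc1⟩ : ∃ c, q ≤ deriv U c ∧ 0 < c :=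
    ((hU.inada_zero.eventually_ge_atTop q).and self_mem_nhdsWithin).exists
  obtain ⟨c₂, h2, hc2⟩ : ∃ c, deriv U c < q ∧ 0 < c :=
    ((hU.inada_top.eventually_lt_const hq).and (eventually_gt_atTop 0)).exists
  obtain ⟨c, hc, hcq⟩ := (isPreconnected_Ioi (a := (0 : ℝ))).intermediate_value hc2 hc1
    hU.continuousOn_deriv ⟨h2.le, h1⟩
  exact ⟨c, hc, hcq⟩

/-- `c ↦ U(c) - c U'(c)` is strictly increasing, with a quantitative bound. -/
theorem mul_deriv_sub_lt (hU : UtilityAssumptions U γ K₁) {c c' : ℝ} (hc' : 0 < c')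
    (h : c' < c) : c' * (deriv U c' - deriv U c) <
      (U c - c * deriv U c) - (U c' - c' * deriv U c') := by
  have := hU.lt_tangent (hc'.trans h) hc'.le h.ne
  linarith

/-- At the price `q = U'(c)` this function is the maximum of `U(z) - z q`. Its injectivity allows
the consumption rate to be recovered from the Hamilton-Jacobi-Bellman equation. -/
theorem strictMonoOn_sub_mul_deriv (hU : UtilityAssumptions U γ K₁) :
    StrictMonoOn (fun c => U c - c * deriv U c) (Ioi 0) := by
  intro c' hc' c hc h
  have h1 := hU.mul_deriv_sub_lt hc' h
  have h2 := mul_pos hc' (sub_pos.2 (hU.strictAntiOn_deriv hc' hc h))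
  simp only
  linarith

theorem sub_mul_deriv_nonneg (hU : UtilityAssumptions U γ K₁) {c : ℝ} (hc : 0 < c) :
    0 ≤ U c - c * deriv U c := by
  have := hU.le_tangent hc le_rfl
  rw [hU.zero] at this
  linarith

theorem continuousOn_sub_mul_deriv (hU : UtilityAssumptions U γ K₁) :
    ContinuousOn (fun c => U c - c * deriv U c) (Ioi 0) :=
  (hU.contDiff.continuousOn).sub (continuousOn_id.mul hU.continuousOn_deriv)

theorem le_affine (hU : UtilityAssumptions U γ K₁) {c : ℝ} (hc : 0 ≤ c) : U c ≤ K₁ * (1 + c) :=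
  (hU.growth c hc).trans
    (mul_le_mul_of_nonneg_left (rpow_le_one_add hc hU.γ_pos hU.γ_lt_one) hU.K₁_pos.le)

end UtilityAssumptions

/-! ### The autonomous deterministic problem. -/

/-- A reward rate received while holding wealth. -/
structure RewardAssumptions (G : ℝ → ℝ) : Prop where
  concave : ConcaveOn ℝ (Ici 0) G
  mono : MonotoneOn G (Ici 0)
  nonneg : ∀ y, 0 ≤ y → 0 ≤ G y

/-- A deterministic consumption rate, started at time `0`, which never exhausts more than the
initial wealth `y`. -/
structure IsPlan (y : ℝ) (c : ℝ → ℝ) : Prop where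
  measurable : Measurable c
  rate_nonneg : ∀ s, 0 ≤ s → 0 ≤ c s
  bound : ∀ s, 0 ≤ s → IntervalIntegrable c volume 0 s ∧ ∫ u in (0 : ℝ)..s, c u ≤ y

/-- Discounted utility of consumption plus reward of the remaining wealth, from time `0` on. -/
def payoff (δ : ℝ) (U G : ℝ → ℝ) (y : ℝ) (c : ℝ → ℝ) : ℝ≥0∞ :=
  ∫⁻ s in Ioi (0 : ℝ), ENNReal.ofReal (Real.exp (-δ * s) * (U (c s) + G (wealthPath 0 y c s)))

/-- The value of the deterministic consumption problem with initial wealth `y`. -/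
def optValue (δ : ℝ) (U G : ℝ → ℝ) (y : ℝ) : ℝ :=
  (⨆ (c : ℝ → ℝ) (_ : IsPlan y c), payoff δ U G y c).toReal

section Plans

variable {y y' : ℝ} {c : ℝ → ℝ}

theorem IsPlan.wealthPath_nonneg (hc : IsPlan y c) {s : ℝ} (hs : 0 ≤ s) :
    0 ≤ wealthPath 0 y c s := by
  have := (hc.bound s hs).2
  unfold wealthPath
  linarith

theorem IsPlan.wealthPath_le (hc : IsPlan y c) {s : ℝ} (hs : 0 ≤ s) :
    wealthPath 0 y c s ≤ y := by
  have := intervalIntegral.integral_nonneg (μ := volume) hs fun u hu => hc.rate_nonneg u hu.1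
  unfold wealthPath
  linarith

theorem IsPlan.nonneg (hc : IsPlan y c) : 0 ≤ y := by
  simpa using (hc.bound 0 le_rfl).2

theorem IsPlan.lintegral_le (hc : IsPlan y c) :
    ∫⁻ s in Ioi (0 : ℝ), ENNReal.ofReal (c s) ≤ ENNReal.ofReal y := by
  have h0 : ∀ n : ℕ, ∀ᵐ s ∂(volume.restrict (Ioc (0 : ℝ) n)), 0 ≤ c s := fun n =>
    (ae_restrict_mem measurableSet_Ioc).mono fun s hs => hc.rate_nonneg s hs.1.le
  have hU : Ioi (0 : ℝ) = ⋃ n : ℕ, Ioc (0 : ℝ) n := by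
    ext s
    simp only [mem_Ioi, mem_iUnion, mem_Ioc]
    exact ⟨fun h => (exists_nat_ge s).imp fun n hn => ⟨h, hn⟩, fun ⟨_, h, _⟩ => h⟩
  rw [hU, setLIntegral_iUnion_of_directed _
    (directed_of_isDirected_le fun m n hmn => Ioc_subset_Ioc_right (by exact_mod_cast hmn))]
  refine iSup_le fun n => ?_
  obtain ⟨h1, h2⟩ := hc.bound n n.cast_nonneg
  rw [← ofReal_integral_eq_lintegral_ofReal h1.1 (h0 n),
    ← intervalIntegral.integral_of_le n.cast_nonneg]
  exact ENNReal.ofReal_le_ofReal (by linarith)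

theorem IsPlan.wealthPath_shift (hc : IsPlan y c) {h s : ℝ} (hh : 0 ≤ h)
    (hs : 0 ≤ s) : wealthPath 0 (wealthPath 0 y c h) (fun u => c (u + h)) s =
      wealthPath 0 y c (s + h) := by
  unfold wealthPath
  rw [intervalIntegral.integral_comp_add_right (fun u => c u), zero_add]
  have h1 := (hc.bound h hh).1
  have h2 := (hc.bound (s + h) (by linarith)).1
  rw [← intervalIntegral.integral_add_adjacent_intervals h1 (h1.symm.trans h2)]
  ring

theorem IsPlan.shift (hc : IsPlan y c) {h : ℝ} (hh : 0 ≤ h) :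
    IsPlan (wealthPath 0 y c h) (fun u => c (u + h)) := by
  refine ⟨hc.measurable.comp (measurable_id.add_const h), fun s hs => hc.rate_nonneg _ (by linarith),
    fun s hs => ⟨?_, ?_⟩⟩
  · have h1 := (hc.bound h hh).1
    have h2 := (hc.bound (s + h) (by linarith)).1
    have := (h1.symm.trans h2).comp_add_right h
    simpa using this
  · have h1 := hc.wealthPath_shift hh hs
    have h2 := hc.wealthPath_nonneg (by linarith : 0 ≤ s + h)
    rw [← h1] at h2
    unfold wealthPath at h2 ⊢
    linarith

/-- Both dynamic programming inequalities rest on this identity, a consequence of the flow property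
of wealth. -/
theorem payoff_split {δ : ℝ} {U G : ℝ → ℝ} (hc : IsPlan y c) {h : ℝ} (hh : 0 ≤ h) :
    payoff δ U G y c = (∫⁻ s in Ioc (0 : ℝ) h,
        ENNReal.ofReal (Real.exp (-δ * s) * (U (c s) + G (wealthPath 0 y c s)))) +
      ENNReal.ofReal (Real.exp (-δ * h)) *
        payoff δ U G (wealthPath 0 y c h) (fun u => c (u + h)) := by
  have hsplit : ∀ F : ℝ → ℝ≥0∞, ∫⁻ s in Ioi (0 : ℝ), F s =
      (∫⁻ s in Ioc (0 : ℝ) h, F s) + ∫⁻ s in Ioi h, F s := by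
    intro F
    rw [← Ioc_union_Ioi_eq_Ioi hh, lintegral_union measurableSet_Ioi Ioc_disjoint_Ioi_same]
  unfold payoff
  rw [hsplit]
  congr 1
  rw [← lintegral_const_mul' _ _ ENNReal.ofReal_ne_top]
  have hmp : MeasurePreserving (fun s : ℝ => s + h) volume volume :=
    measurePreserving_add_right volume h
  have hpre : (fun s : ℝ => s + h) ⁻¹' Ioi h = Ioi 0 := by ext; simp
  rw [← hmp.setLIntegral_comp_preimage_emb (measurableEmbedding_addRight h) _ (Ioi h), hpre]
  refine setLIntegral_congr_fun measurableSet_Ioi fun s hs => ?_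
  simp only
  rw [hc.wealthPath_shift hh (le_of_lt hs), ← ENNReal.ofReal_mul (Real.exp_pos _).le,
    ← mul_assoc, ← Real.exp_add]
  congr 3
  ring_nf

end Plans

/-! ### Finiteness and concavity of the deterministic value. -/

section Value

variable {U G : ℝ → ℝ} {γ K₁ δ y y' : ℝ} {c c' : ℝ → ℝ}

/-- Utility is at most affine, total consumption is at most `y`, and the reward never exceeds `G y`.
The uniform bound makes the `toReal` in `optValue` harmless. -/
theorem payoff_le (hU : UtilityAssumptions U γ K₁) (hG : RewardAssumptions G) (hδ : 0 < δ)
    (hc : IsPlan y c) :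
    payoff δ U G y c ≤ ENNReal.ofReal ((K₁ + G y) / δ + K₁ * y) := by
  have hy := hc.nonneg
  have hK := hU.K₁_pos
  have hGy := hG.nonneg y hy
  calc payoff δ U G y c ≤ ∫⁻ s in Ioi (0 : ℝ), (ENNReal.ofReal (K₁ + G y) *
        ENNReal.ofReal (Real.exp (-δ * s)) + ENNReal.ofReal K₁ * ENNReal.ofReal (c s)) := by
        refine setLIntegral_mono' measurableSet_Ioi fun s hs => ?_
        have hs0 : 0 ≤ s := le_of_lt hs
        have hcs := hc.rate_nonneg s hs0
        rw [← ENNReal.ofReal_mul (by positivity), ← ENNReal.ofReal_mul (by positivity),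
          ← ENNReal.ofReal_add (by positivity) (by positivity)]
        apply ENNReal.ofReal_le_ofReal
        have h1 := hU.le_affine hcs
        have h2 := hG.mono (hc.wealthPath_nonneg hs0) hy (hc.wealthPath_le hs0)
        have h3 : Real.exp (-δ * s) ≤ 1 := Real.exp_le_one_iff.2 (by nlinarith)
        have h4 := Real.exp_pos (-δ * s)
        calc _ ≤ Real.exp (-δ * s) * (K₁ * (1 + c s) + G y) := by gcongr
          _ = (K₁ + G y) * Real.exp (-δ * s) + K₁ * c s * Real.exp (-δ * s) := by ring
          _ ≤ (K₁ + G y) * Real.exp (-δ * s) + K₁ * c s * 1 := by gcongr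
          _ = _ := by ring
    _ = ENNReal.ofReal (K₁ + G y) * ENNReal.ofReal (Real.exp (-δ * 0) / δ) +
        ENNReal.ofReal K₁ * ∫⁻ s in Ioi (0 : ℝ), ENNReal.ofReal (c s) := by
        rw [lintegral_add_left (by fun_prop), lintegral_const_mul _ (by fun_prop),
          lintegral_const_mul' _ _ ENNReal.ofReal_ne_top, lintegral_exp_neg_mul_Ioi hδ]
    _ ≤ ENNReal.ofReal (K₁ + G y) * ENNReal.ofReal (Real.exp (-δ * 0) / δ) +
        ENNReal.ofReal K₁ * ENNReal.ofReal y := by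
        gcongr
        exact hc.lintegral_le
    _ = _ := by
        rw [← ENNReal.ofReal_mul (by positivity), ← ENNReal.ofReal_mul (by positivity),
          ← ENNReal.ofReal_add (by positivity) (by positivity)]
        congr 1
        simp
        ring

theorem iSup_payoff_eq (hU : UtilityAssumptions U γ K₁) (hG : RewardAssumptions G) (hδ : 0 < δ)
    (y : ℝ) : ⨆ (c : ℝ → ℝ) (_ : IsPlan y c), payoff δ U G y c =
      ENNReal.ofReal (optValue δ U G y) := by
  rw [optValue, ENNReal.ofReal_toReal]
  exact ne_top_of_le_ne_top ENNReal.ofReal_ne_top (iSup₂_le fun c hc => payoff_le hU hG hδ hc)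

theorem payoff_le_optValue (hU : UtilityAssumptions U γ K₁) (hG : RewardAssumptions G)
    (hδ : 0 < δ) (hc : IsPlan y c) :
    payoff δ U G y c ≤ ENNReal.ofReal (optValue δ U G y) := by
  rw [← iSup_payoff_eq hU hG hδ]
  exact le_iSup₂_of_le c hc le_rfl

theorem optValue_nonneg : 0 ≤ optValue δ U G y := ENNReal.toReal_nonneg

theorem optValue_le {B : ℝ} (hU : UtilityAssumptions U γ K₁) (hG : RewardAssumptions G)
    (hδ : 0 < δ) (hB : 0 ≤ B)
    (h : ∀ c, IsPlan y c → payoff δ U G y c ≤ ENNReal.ofReal B) :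
    optValue δ U G y ≤ B := by
  rw [← ENNReal.ofReal_le_ofReal_iff hB, ← iSup_payoff_eq hU hG hδ]
  exact iSup₂_le h

theorem isPlan_zero (hy : 0 ≤ y) : IsPlan y (fun _ => 0) :=
  ⟨measurable_const, fun _ _ => le_rfl, fun s _ => ⟨intervalIntegrable_const, by simpa using hy⟩⟩

theorem IsPlan.convexCombination {θ θ' : ℝ} (hc : IsPlan y c)
    (hc' : IsPlan y' c') (hθ : 0 ≤ θ) (hθ' : 0 ≤ θ') :
    IsPlan (θ * y + θ' * y') (fun s => θ * c s + θ' * c' s) ∧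
      ∀ s, 0 ≤ s → wealthPath 0 (θ * y + θ' * y') (fun s => θ * c s + θ' * c' s) s =
        θ * wealthPath 0 y c s + θ' * wealthPath 0 y' c' s := by
  have hint : ∀ s, 0 ≤ s → ∫ u in (0 : ℝ)..s, (θ * c u + θ' * c' u) =
      θ * (∫ u in (0 : ℝ)..s, c u) + θ' * ∫ u in (0 : ℝ)..s, c' u := by
    intro s hs
    rw [intervalIntegral.integral_add ((hc.bound s hs).1.const_mul θ)
      ((hc'.bound s hs).1.const_mul θ'), intervalIntegral.integral_const_mul,
      intervalIntegral.integral_const_mul]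
  refine ⟨⟨(hc.measurable.const_mul θ).add (hc'.measurable.const_mul θ'), fun s hs =>
    add_nonneg (mul_nonneg hθ (hc.rate_nonneg s hs)) (mul_nonneg hθ' (hc'.rate_nonneg s hs)), fun s hs =>
    ⟨((hc.bound s hs).1.const_mul θ).add ((hc'.bound s hs).1.const_mul θ'), ?_⟩⟩, fun s hs => ?_⟩
  · rw [hint s hs]
    nlinarith [mul_le_mul_of_nonneg_left (hc.bound s hs).2 hθ,
      mul_le_mul_of_nonneg_left (hc'.bound s hs).2 hθ']
  · unfold wealthPath
    rw [hint s hs]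
    ring

/-- Pointwise concavity of the integrand of the payoff. -/
theorem payoff_integrand_concave (hU : UtilityAssumptions U γ K₁) (hG : RewardAssumptions G)
    {θ θ' : ℝ} (hc : IsPlan y c)
    (hc' : IsPlan y' c') (hθ : 0 ≤ θ) (hθ' : 0 ≤ θ') (hsum : θ + θ' = 1) {s : ℝ}
    (hs : 0 ≤ s) :
    ENNReal.ofReal θ * ENNReal.ofReal (Real.exp (-δ * s) * (U (c s) + G (wealthPath 0 y c s))) +
      ENNReal.ofReal θ' *
        ENNReal.ofReal (Real.exp (-δ * s) * (U (c' s) + G (wealthPath 0 y' c' s))) ≤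
      ENNReal.ofReal (Real.exp (-δ * s) * (U (θ * c s + θ' * c' s) +
        G (wealthPath 0 (θ * y + θ' * y') (fun s => θ * c s + θ' * c' s) s))) := by
  rw [(hc.convexCombination hc' hθ hθ').2 s hs]
  have h1 := hc.rate_nonneg s hs
  have h2 := hc'.rate_nonneg s hs
  have h3 := hc.wealthPath_nonneg hs
  have h4 := hc'.wealthPath_nonneg hs
  have h5 := hU.nonneg h1
  have h6 := hU.nonneg h2
  have h7 := hG.nonneg _ h3
  have h8 := hG.nonneg _ h4
  have e1 := hU.strictConcave.concaveOn.2 h1 h2 hθ hθ' hsum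
  have e2 := hG.concave.2 h3 h4 hθ hθ' hsum
  simp only [smul_eq_mul] at e1 e2
  rw [← ENNReal.ofReal_mul hθ, ← ENNReal.ofReal_mul hθ', ← ENNReal.ofReal_add (by positivity)
    (by positivity)]
  apply ENNReal.ofReal_le_ofReal
  have := mul_le_mul_of_nonneg_left (add_le_add e1 e2) (Real.exp_pos (-δ * s)).le
  linarith

theorem optValue_concaveOn (hU : UtilityAssumptions U γ K₁) (hG : RewardAssumptions G)
    (hδ : 0 < δ) : ConcaveOn ℝ (Ici 0) (optValue δ U G) := by
  refine ⟨convex_Ici 0, fun y hy y' hy' θ θ' hθ hθ' hsum => ?_⟩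
  simp only [smul_eq_mul]
  rw [← ENNReal.ofReal_le_ofReal_iff optValue_nonneg,
    ENNReal.ofReal_add (mul_nonneg hθ optValue_nonneg) (mul_nonneg hθ' optValue_nonneg),
    ENNReal.ofReal_mul hθ, ENNReal.ofReal_mul hθ', ← iSup_payoff_eq hU hG hδ,
    ← iSup_payoff_eq hU hG hδ]
  simp_rw [ENNReal.mul_iSup]
  refine ENNReal.biSup_add_biSup_le' ⟨_, isPlan_zero hy⟩
    ⟨_, isPlan_zero hy'⟩ fun c hc c' hc' => ?_
  refine le_trans ?_ (payoff_le_optValue hU hG hδ (hc.convexCombination hc' hθ hθ').1)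
  unfold payoff
  rw [← lintegral_const_mul' _ _ ENNReal.ofReal_ne_top,
    ← lintegral_const_mul' _ _ ENNReal.ofReal_ne_top]
  exact (le_lintegral_add _ _).trans (setLIntegral_mono' measurableSet_Ioi fun s hs =>
    payoff_integrand_concave hU hG hc hc' hθ hθ' hsum (le_of_lt hs))

end Value

/-! ### Increments of the value and dynamic programming. -/

theorem lintegral_exp_neg_mul_Ioc {δ : ℝ} (hδ : 0 < δ) {h : ℝ} (hh : 0 ≤ h) :
    ∫⁻ t in Ioc 0 h, ENNReal.ofReal (Real.exp (-δ * t)) =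
      ENNReal.ofReal ((1 - Real.exp (-δ * h)) / δ) := by
  have hint : IntervalIntegrable (fun t => Real.exp (-δ * t)) volume 0 h :=
    (by fun_prop : Continuous fun t => Real.exp (-δ * t)).intervalIntegrable _ _
  rw [← ofReal_integral_eq_lintegral_ofReal hint.1
    (Eventually.of_forall fun _ => (Real.exp_pos _).le), ← intervalIntegral.integral_of_le hh]
  congr 1
  rw [intervalIntegral.integral_eq_sub_of_hasDerivAt
    (f := fun t => -(Real.exp (-δ * t) / δ)) (fun t _ => ?_) hint]
  · simp; ring
  · have := (((hasDerivAt_id t).const_mul (-δ)).exp.div_const δ).neg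
    exact this.congr_deriv (by simp only [id]; field_simp)

/-- Markov's inequality: total consumption is at most `y`, so the rate reaches `2 * y` on measure at
most one half. -/
theorem IsPlan.half_le_volume {y : ℝ} {c : ℝ → ℝ} (hc : IsPlan y c) (hy : 0 < y) :
    2⁻¹ ≤ volume ({s | c s < 2 * y} ∩ Ioc 0 1) := by
  set μ := volume.restrict (Ioc (0 : ℝ) 1) with hμ
  have hμ1 : μ univ = 1 := by simp [hμ]
  have h1 : μ {s | ENNReal.ofReal (2 * y) ≤ ENNReal.ofReal (c s)} ≤ 2⁻¹ := by
    refine (meas_ge_le_lintegral_div hc.measurable.ennreal_ofReal.aemeasurable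
      (by simpa using hy) ENNReal.ofReal_ne_top).trans ?_
    refine ENNReal.div_le_of_le_mul ?_
    rw [ENNReal.ofReal_mul zero_le_two, ENNReal.ofReal_ofNat, ← mul_assoc,
      ENNReal.inv_mul_cancel two_ne_zero ENNReal.ofNat_ne_top, one_mul]
    exact (lintegral_mono_set Ioc_subset_Ioi_self).trans hc.lintegral_le
  have h2 : {s | ENNReal.ofReal (2 * y) ≤ ENNReal.ofReal (c s)} = {s | c s < 2 * y}ᶜ := by
    ext s
    simp only [mem_ofPred_eq, mem_compl_iff, not_lt]
    exact ⟨fun h => (ENNReal.ofReal_le_ofReal_iff' .. |>.1 h).elim id fun h => by linarith,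
      ENNReal.ofReal_le_ofReal⟩
  have hm : MeasurableSet {s | c s < 2 * y} := measurableSet_lt hc.measurable measurable_const
  rw [h2] at h1
  have h3 := measure_add_measure_compl (μ := μ) hm
  rw [hμ1] at h3
  rw [← Measure.restrict_apply hm]
  by_contra! hlt
  have : μ {s | c s < 2 * y} + μ {s | c s < 2 * y}ᶜ < 2⁻¹ + 2⁻¹ :=
    ENNReal.add_lt_add_of_lt_of_le (ne_top_of_le_ne_top (by simp) h1) hlt h1
  rw [h3, ENNReal.inv_two_add_inv_two] at this
  exact lt_irrefl _ this

/-- The increments of a concave function decrease. -/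
theorem concaveOn_increment_le {f : ℝ → ℝ} (hf : ConcaveOn ℝ (Ici 0) f) {a b d : ℝ} (ha : 0 ≤ a)
    (hab : a < b) (hd : 0 < d) : f (b + d) - f b ≤ f (a + d) - f a := by
  have hpos : 0 < b + d - a := by linarith
  have hne : b + d - a ≠ 0 := hpos.ne'
  have hbd : b + d ∈ Ici (0 : ℝ) := by simp only [mem_Ici]; linarith
  have h1 : 0 ≤ d / (b + d - a) := by positivity
  have h2 : 0 ≤ (b - a) / (b + d - a) := div_nonneg (by linarith) hpos.le
  -- Both inner points are convex combinations of `a` and `b + d`, with exchanged weights; adding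
  -- the two concavity inequalities gives the claim.
  have e1 : d / (b + d - a) * a + (b - a) / (b + d - a) * (b + d) = b := by field_simp; ring
  have e2 : (b - a) / (b + d - a) * a + d / (b + d - a) * (b + d) = a + d := by field_simp; ring
  have e3 : d / (b + d - a) = 1 - (b - a) / (b + d - a) := by field_simp; ring
  have h3 := hf.2 ha hbd h1 h2 (by rw [e3]; ring)
  have h4 := hf.2 ha hbd h2 h1 (by rw [e3]; ring)
  simp only [smul_eq_mul] at h3 h4
  rw [e1] at h3
  rw [e2] at h4
  rw [e3] at h3 h4
  linarith

section Value

variable {U G : ℝ → ℝ} {γ K₁ δ y y' : ℝ} {c c' : ℝ → ℝ}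

/-- Consuming additional wealth uniformly over the first unit of time. -/
theorem IsPlan.add_indicator (hc : IsPlan y' c) {h : ℝ} (hh : 0 ≤ h) :
    IsPlan (y' + h) (fun s => c s + (Ioc (0 : ℝ) 1).indicator (fun _ => h) s) ∧
      ∀ s, 0 ≤ s → wealthPath 0 y' c s ≤
        wealthPath 0 (y' + h) (fun s => c s + (Ioc (0 : ℝ) 1).indicator (fun _ => h) s) s := by
  have hi : ∀ s, IntervalIntegrable ((Ioc (0 : ℝ) 1).indicator (fun _ => h)) volume 0 s := by
    intro s
    exact ((integrable_indicator_iff measurableSet_Ioc).2 (by simp)).intervalIntegrable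
  have hle : ∀ s, 0 ≤ s → ∫ u in (0 : ℝ)..s, (Ioc (0 : ℝ) 1).indicator (fun _ => h) u ≤ h := by
    intro s hs
    rw [intervalIntegral.integral_of_le hs]
    calc _ ≤ ∫ u, (Ioc (0 : ℝ) 1).indicator (fun _ => h) u := by
          refine setIntegral_le_integral ((integrable_indicator_iff measurableSet_Ioc).2 (by simp))
            (Eventually.of_forall fun u => indicator_nonneg (fun _ _ => hh) u)
      _ = h := by rw [integral_indicator measurableSet_Ioc]; simp
  have hadd : ∀ s, 0 ≤ s →
      ∫ u in (0 : ℝ)..s, (c u + (Ioc (0 : ℝ) 1).indicator (fun _ => h) u) =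
      (∫ u in (0 : ℝ)..s, c u) + ∫ u in (0 : ℝ)..s, (Ioc (0 : ℝ) 1).indicator (fun _ => h) u :=
    fun s hs => intervalIntegral.integral_add (hc.bound s hs).1 (hi s)
  refine ⟨⟨hc.measurable.add (measurable_const.indicator measurableSet_Ioc), fun s hs =>
    add_nonneg (hc.rate_nonneg s hs) (indicator_nonneg (fun _ _ => hh) s), fun s hs =>
    ⟨(hc.bound s hs).1.add (hi s), ?_⟩⟩, fun s hs => ?_⟩
  · rw [hadd s hs]
    exact add_le_add (hc.bound s hs).2 (hle s hs)
  · unfold wealthPath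
    rw [hadd s hs]
    linarith [hle s hs]

/-- The extra wealth is consumed uniformly over `(0, 1]`. For at least half of that time the
original rate is below `2 * y'`, so concavity of `U` bounds the gain from below. This is how
infinite marginal utility at `0` passes to the value. -/
theorem optValue_increment (hU : UtilityAssumptions U γ K₁) (hG : RewardAssumptions G)
    (hδ : 0 < δ) (hy' : 0 < y') (h : y' < y) :
    optValue δ U G y' + Real.exp (-δ) / 2 * (U (2 * y' + (y - y')) - U (2 * y')) ≤
      optValue δ U G y := by
  set d := y - y' with hd
  have hd0 : 0 < d := by linarith
  set g := U (2 * y' + d) - U (2 * y') with hg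
  have hg0 : 0 ≤ g := sub_nonneg.2 (hU.strictMono.monotoneOn (by simp only [mem_Ici]; linarith)
    (by simp only [mem_Ici]; linarith) (by linarith))
  have key : ∀ c, IsPlan y' c → payoff δ U G y' c + ENNReal.ofReal (Real.exp (-δ) / 2 * g) ≤
      ENNReal.ofReal (optValue δ U G y) := by
    intro c hc
    obtain ⟨hp, hw⟩ := hc.add_indicator hd0.le
    have hyd : y' + d = y := by rw [hd]; ring
    rw [hyd] at hp hw
    refine le_trans ?_ (payoff_le_optValue hU hG hδ hp)
    set E := {s | c s < 2 * y'} ∩ Ioc 0 1 with hE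
    have hEm : MeasurableSet E :=
      (measurableSet_lt hc.measurable measurable_const).inter measurableSet_Ioc
    have hEsub : E ⊆ Ioi 0 := fun s hs => hs.2.1
    calc _ ≤ payoff δ U G y' c + ∫⁻ s in Ioi 0,
          E.indicator (fun _ => ENNReal.ofReal (Real.exp (-δ) * g)) s := by
          gcongr
          rw [lintegral_indicator hEm, setLIntegral_const, Measure.restrict_apply hEm,
            inter_eq_self_of_subset_left hEsub, div_mul_eq_mul_div, div_eq_mul_inv,
            ENNReal.ofReal_mul (by positivity), ENNReal.ofReal_inv_of_pos two_pos,
            ENNReal.ofReal_ofNat]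
          exact mul_le_mul_right (hc.half_le_volume hy') _
      _ ≤ _ := by
          unfold payoff
          refine (le_lintegral_add _ _).trans (setLIntegral_mono' measurableSet_Ioi fun s hs => ?_)
          have hs0 : 0 ≤ s := le_of_lt hs
          have hcs := hc.rate_nonneg s hs0
          have hG1 := hG.mono (hc.wealthPath_nonneg hs0) (hp.wealthPath_nonneg hs0) (hw s hs0)
          have hexp := Real.exp_pos (-δ * s)
          have h1 := hU.nonneg hcs
          have h2 := hG.nonneg _ (hc.wealthPath_nonneg hs0)
          beta_reduce
          by_cases hsE : s ∈ E
          · rw [indicator_of_mem hsE, indicator_of_mem hsE.2, ← ENNReal.ofReal_add (by positivity)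
              (by positivity)]
            apply ENNReal.ofReal_le_ofReal
            have h3 : g ≤ U (c s + d) - U (c s) := by
              have hlt : c s < 2 * y' := hsE.1
              exact concaveOn_increment_le hU.strictConcave.concaveOn hcs hlt hd0
            have h6 : Real.exp (-δ) ≤ Real.exp (-δ * s) :=
              Real.exp_le_exp.2 (by nlinarith [hsE.2.2])
            calc _ ≤ Real.exp (-δ * s) * (U (c s) + G (wealthPath 0 y' c s)) +
                  Real.exp (-δ * s) * g := by gcongr
              _ = Real.exp (-δ * s) * (U (c s) + g + G (wealthPath 0 y' c s)) := by ring
              _ ≤ _ := by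
                gcongr
                linarith
          · rw [indicator_of_notMem hsE, add_zero]
            apply ENNReal.ofReal_le_ofReal
            have h3 : U (c s) ≤ U (c s + (Ioc (0 : ℝ) 1).indicator (fun _ => d) s) :=
              hU.strictMono.monotoneOn hcs (hp.rate_nonneg s hs0)
                (le_add_of_nonneg_right (indicator_nonneg (fun _ _ => hd0.le) s))
            gcongr
  -- The bound given to `optValue_le` must be nonnegative; the zero plan shows it.
  have hgw : Real.exp (-δ) / 2 * g ≤ optValue δ U G y := by
    rw [← ENNReal.ofReal_le_ofReal_iff optValue_nonneg]
    exact le_add_self.trans (key _ (isPlan_zero hy'.le))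
  have : optValue δ U G y' ≤ optValue δ U G y - Real.exp (-δ) / 2 * g := by
    refine optValue_le hU hG hδ (by linarith) fun c hc => ?_
    rw [ENNReal.ofReal_sub _ (by positivity)]
    exact ENNReal.le_sub_of_add_le_right ENNReal.ofReal_ne_top (key c hc)
  linarith

/-- Consuming at the constant rate `c₀` up to time `h`, then following a given plan. -/
theorem IsPlan.concat {c₀ h : ℝ} (hc₀ : 0 ≤ c₀) (hh : 0 ≤ h) (hc : IsPlan (y - c₀ * h) c) :
    IsPlan y (fun s => if s ≤ h then c₀ else c (s - h)) ∧
      ∀ s, 0 ≤ s → s ≤ h →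
        wealthPath 0 y (fun s => if s ≤ h then c₀ else c (s - h)) s = y - c₀ * s := by
  set e : ℝ → ℝ := fun s => if s ≤ h then c₀ else c (s - h) with he
  have h1 : ∀ s, 0 ≤ s → s ≤ h → IntervalIntegrable e volume 0 s ∧
      ∫ u in (0 : ℝ)..s, e u = c₀ * s := by
    intro s hs hsh
    have hcongr : EqOn (fun _ => c₀) e (Ioc 0 s) := fun u hu => by
      simp only [he, if_pos (hu.2.trans hsh)]
    constructor
    · rw [intervalIntegrable_iff_integrableOn_Ioc_of_le hs]
      exact IntegrableOn.congr_fun (by simp) hcongr measurableSet_Ioc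
    · rw [intervalIntegral.integral_of_le hs, ← setIntegral_congr_fun measurableSet_Ioc hcongr]
      simp [hs, mul_comm]
  have h2 : ∀ s, h ≤ s → IntervalIntegrable e volume h s ∧
      ∫ u in h..s, e u = ∫ u in (0 : ℝ)..(s - h), c u := by
    intro s hs
    have hcongr : EqOn (fun u => c (u - h)) e (Ioc h s) := fun u hu => by
      simp only [he, if_neg (not_le.2 hu.1)]
    have hi : IntervalIntegrable (fun u => c (u - h)) volume h s := by
      simpa using (hc.bound (s - h) (by linarith)).1.comp_sub_right h
    constructor
    · rw [intervalIntegrable_iff_integrableOn_Ioc_of_le hs] at hi ⊢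
      exact IntegrableOn.congr_fun hi hcongr measurableSet_Ioc
    · rw [intervalIntegral.integral_of_le hs, ← setIntegral_congr_fun measurableSet_Ioc hcongr,
        ← intervalIntegral.integral_of_le hs,
        intervalIntegral.integral_comp_sub_right (fun u => c u), sub_self]
  refine ⟨⟨Measurable.ite measurableSet_Iic measurable_const
    (hc.measurable.comp (measurable_id.sub_const h)), fun s hs => ?_, fun s hs => ?_⟩,
    fun s hs hsh => by unfold wealthPath; rw [(h1 s hs hsh).2]⟩
  · simp only [he]
    split_ifs with hsh
    · exact hc₀
    · exact hc.rate_nonneg _ (by linarith)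
  · rcases le_total s h with hsh | hsh
    · refine ⟨(h1 s hs hsh).1, ?_⟩
      rw [(h1 s hs hsh).2]
      nlinarith [hc.nonneg]
    · refine ⟨(h1 h hh le_rfl).1.trans (h2 s hsh).1, ?_⟩
      rw [← intervalIntegral.integral_add_adjacent_intervals (h1 h hh le_rfl).1 (h2 s hsh).1,
        (h1 h hh le_rfl).2, (h2 s hsh).2]
      linarith [(hc.bound (s - h) (by linarith)).2]

/-- Lower dynamic programming inequality: a constant rate is used up to `h`, followed by an
arbitrary plan. On `[0, h]` the reward is at least its value at the final wealth. -/
theorem optValue_ge_concat (hU : UtilityAssumptions U γ K₁) (hG : RewardAssumptions G)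
    (hδ : 0 < δ) {c₀ h : ℝ} (hc₀ : 0 ≤ c₀) (hh : 0 ≤ h) (hy : c₀ * h ≤ y) :
    (1 - Real.exp (-δ * h)) / δ * (U c₀ + G (y - c₀ * h)) +
      Real.exp (-δ * h) * optValue δ U G (y - c₀ * h) ≤ optValue δ U G y := by
  have hexp : Real.exp (-δ * h) ≤ 1 := Real.exp_le_one_iff.2 (by nlinarith)
  have hE : 0 ≤ (1 - Real.exp (-δ * h)) / δ := div_nonneg (by linarith) hδ.le
  have hr : 0 ≤ U c₀ + G (y - c₀ * h) :=
    add_nonneg (hU.nonneg hc₀) (hG.nonneg _ (by linarith))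
  set F := (1 - Real.exp (-δ * h)) / δ * (U c₀ + G (y - c₀ * h)) with hF
  have hF0 : 0 ≤ F := mul_nonneg hE hr
  have key : ∀ c, IsPlan (y - c₀ * h) c → ENNReal.ofReal (Real.exp (-δ * h)) *
      payoff δ U G (y - c₀ * h) c + ENNReal.ofReal F ≤ ENNReal.ofReal (optValue δ U G y) := by
    intro c hc
    obtain ⟨hp, hw⟩ := hc.concat hc₀ hh
    refine le_trans (le_of_eq_of_le (add_comm _ _) ?_) (payoff_le_optValue hU hG hδ hp)
    rw [payoff_split hp hh]
    refine add_le_add ?_ (le_of_eq ?_)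
    · rw [hF, ENNReal.ofReal_mul hE, ← lintegral_exp_neg_mul_Ioc hδ hh,
        ← lintegral_mul_const _ (by fun_prop)]
      refine setLIntegral_mono' measurableSet_Ioc fun s hs => ?_
      rw [← ENNReal.ofReal_mul (Real.exp_pos _).le, hw s hs.1.le hs.2, if_pos hs.2]
      apply ENNReal.ofReal_le_ofReal
      have h1 : c₀ * s ≤ c₀ * h := mul_le_mul_of_nonneg_left hs.2 hc₀
      have := hG.mono (by simp only [mem_Ici]; linarith : y - c₀ * h ∈ Ici 0)
        (by simp only [mem_Ici]; linarith : y - c₀ * s ∈ Ici 0) (by linarith)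
      gcongr
    · congr 1
      rw [hw h hh le_rfl]
      refine setLIntegral_congr_fun measurableSet_Ioi fun s hs => ?_
      have hs0 : (0 : ℝ) < s := hs
      have hcongr : ∫ u in (0 : ℝ)..s, c u =
          ∫ u in (0 : ℝ)..s, (fun u => if u + h ≤ h then c₀ else c (u + h - h)) u := by
        rw [intervalIntegral.integral_of_le hs0.le, intervalIntegral.integral_of_le hs0.le]
        refine setIntegral_congr_fun measurableSet_Ioc fun u hu => ?_
        rw [if_neg (by linarith [hu.1]), add_sub_cancel_right]
      unfold wealthPath
      rw [← hcongr]
      beta_reduce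
      rw [if_neg (by linarith), add_sub_cancel_right]
  have hle : F ≤ optValue δ U G y := by
    rw [← ENNReal.ofReal_le_ofReal_iff optValue_nonneg]
    exact le_add_self.trans (key _ (isPlan_zero (by linarith)))
  have : optValue δ U G (y - c₀ * h) ≤ (optValue δ U G y - F) / Real.exp (-δ * h) := by
    refine optValue_le hU hG hδ (div_nonneg (by linarith) (Real.exp_pos _).le) fun c hc => ?_
    rw [ENNReal.ofReal_div_of_pos (Real.exp_pos _),
      ENNReal.le_div_iff_mul_le (Or.inl (by simp [Real.exp_pos])) (Or.inl ENNReal.ofReal_ne_top),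
      ENNReal.ofReal_sub _ hF0, mul_comm]
    exact ENNReal.le_sub_of_add_le_right ENNReal.ofReal_ne_top (key c hc)
  rw [le_div_iff₀ (Real.exp_pos _)] at this
  linarith

/-- The dynamic programming upper bound, in terms of a supergradient `m` of the value function. -/
theorem optValue_le_of_supergradient (hU : UtilityAssumptions U γ K₁) (hG : RewardAssumptions G)
    (hδ : 0 < δ) (hy : 0 ≤ y) {m : ℝ} (hm : 0 ≤ m)
    (hsup : ∀ z, 0 ≤ z → optValue δ U G z ≤ optValue δ U G y + m * (z - y)) {h c₀ : ℝ}
    (hh : 0 < h) (hc₀ : 0 < c₀) (hderiv : deriv U c₀ = m * Real.exp (-δ * h)) :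
    δ * optValue δ U G y ≤ U c₀ - c₀ * deriv U c₀ + G y := by
  have hΓ := hU.sub_mul_deriv_nonneg hc₀
  have hGy := hG.nonneg y hy
  have hexp := Real.exp_pos (-δ * h)
  have hexp1 : Real.exp (-δ * h) < 1 := Real.exp_lt_one_iff.2 (by nlinarith)
  set Γ := U c₀ - c₀ * deriv U c₀ with hΓdef
  have hE : 0 ≤ (1 - Real.exp (-δ * h)) / δ := div_nonneg (by linarith) hδ.le
  have key : optValue δ U G y ≤ (1 - Real.exp (-δ * h)) / δ * (Γ + G y) +
      Real.exp (-δ * h) * optValue δ U G y := by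
    refine optValue_le hU hG hδ (add_nonneg (by positivity)
      (mul_nonneg hexp.le optValue_nonneg)) fun c hc => ?_
    have hI := (hc.bound h hh.le).1
    set I := ∫ u in (0 : ℝ)..h, c u with hIdef
    have hI0 : 0 ≤ I := intervalIntegral.integral_nonneg hh.le fun u hu => hc.rate_nonneg u hu.1
    have hYh : optValue δ U G (wealthPath 0 y c h) ≤ optValue δ U G y - m * I := by
      refine (hsup _ (hc.wealthPath_nonneg hh.le)).trans (le_of_eq ?_)
      unfold wealthPath
      ring
    have hpos : 0 ≤ optValue δ U G y - m * I := optValue_nonneg.trans hYh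
    have hfirst : ∫⁻ s in Ioc (0 : ℝ) h,
        ENNReal.ofReal (Real.exp (-δ * s) * (U (c s) + G (wealthPath 0 y c s))) ≤
        ENNReal.ofReal ((1 - Real.exp (-δ * h)) / δ * (Γ + G y)) +
          ENNReal.ofReal (Real.exp (-δ * h) * (m * I)) := by
      calc _ ≤ ∫⁻ s in Ioc (0 : ℝ) h, (ENNReal.ofReal (Real.exp (-δ * s)) *
            ENNReal.ofReal (Γ + G y) +
              ENNReal.ofReal (Real.exp (-δ * h) * m) * ENNReal.ofReal (c s)) := by
            refine setLIntegral_mono' measurableSet_Ioc fun s hs => ?_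
            have hs0 := hs.1.le
            have hcs := hc.rate_nonneg s hs0
            have hes := Real.exp_pos (-δ * s)
            rw [← ENNReal.ofReal_mul hes.le, ← ENNReal.ofReal_mul (by positivity),
              ← ENNReal.ofReal_add (by positivity) (by positivity)]
            apply ENNReal.ofReal_le_ofReal
            have h1 := hU.le_tangent hc₀ hcs
            have h2 := hG.mono (hc.wealthPath_nonneg hs0) hy (hc.wealthPath_le hs0)
            have h3 : Real.exp (-δ * s) ≤ 1 := Real.exp_le_one_iff.2 (by nlinarith)
            -- The tangent at `c₀` charges consumption at the price `m e^{-δh}`. Its total over `[0,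
            -- h]` is exactly the discounted loss `e^{-δh} m I` in the supergradient bound on the
            -- continuation value, so the two cancel.
            have h4 : U (c s) ≤ Γ + m * Real.exp (-δ * h) * c s := by
              rw [hΓdef, ← hderiv]
              linarith
            have h5 : 0 ≤ m * Real.exp (-δ * h) * c s := by positivity
            calc _ ≤ Real.exp (-δ * s) * (Γ + m * Real.exp (-δ * h) * c s + G y) := by gcongr
              _ = Real.exp (-δ * s) * (Γ + G y) +
                  m * Real.exp (-δ * h) * c s * Real.exp (-δ * s) := by ring
              _ ≤ Real.exp (-δ * s) * (Γ + G y) + m * Real.exp (-δ * h) * c s * 1 := by gcongr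
              _ = _ := by ring
        _ = _ := by
            rw [lintegral_add_left (by fun_prop), lintegral_mul_const _ (by fun_prop),
              lintegral_const_mul' _ _ ENNReal.ofReal_ne_top, lintegral_exp_neg_mul_Ioc hδ hh.le,
              ← ofReal_integral_eq_lintegral_ofReal hI.1
                ((ae_restrict_mem measurableSet_Ioc).mono fun s hs => hc.rate_nonneg s hs.1.le),
              ← intervalIntegral.integral_of_le hh.le, ← ENNReal.ofReal_mul hE,
              ← ENNReal.ofReal_mul (by positivity), mul_assoc]
    rw [payoff_split hc hh.le]
    calc _ ≤ (ENNReal.ofReal ((1 - Real.exp (-δ * h)) / δ * (Γ + G y)) +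
          ENNReal.ofReal (Real.exp (-δ * h) * (m * I))) + ENNReal.ofReal (Real.exp (-δ * h)) *
            ENNReal.ofReal (optValue δ U G y - m * I) := by
          refine add_le_add hfirst (mul_le_mul_right ?_ _)
          exact (payoff_le_optValue hU hG hδ (hc.shift hh.le)).trans
            (ENNReal.ofReal_le_ofReal hYh)
      _ = _ := by
          rw [← ENNReal.ofReal_mul hexp.le, ← ENNReal.ofReal_add (by positivity) (by positivity),
            ← ENNReal.ofReal_add (by positivity) (by positivity)]
          congr 1
          ring
  -- The factor `1 - e^{-δh}` is positive and cancels, so the inequality holds for each `h` without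
  -- a limit.
  have h1 : (1 - Real.exp (-δ * h)) * (δ * optValue δ U G y) ≤
      (1 - Real.exp (-δ * h)) * (Γ + G y) := by
    have h2 : (1 - Real.exp (-δ * h)) / δ * (Γ + G y) * δ =
        (1 - Real.exp (-δ * h)) * (Γ + G y) := by field_simp
    nlinarith
  exact le_of_mul_le_mul_left h1 (by linarith)

end Value

/-! ### Hamilton-Jacobi-Bellman equation and `C¹` regularity. -/

/-- The left derivative of the value function. -/
def marginalValue (δ : ℝ) (U G : ℝ → ℝ) (y : ℝ) : ℝ :=
  -derivWithin (-optValue δ U G) (Iio y) y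

open Classical in
/-- The optimal consumption rate as a function of wealth, given by `U'(C(y)) = w'(y)`. -/
def feedback (δ : ℝ) (U G : ℝ → ℝ) (y : ℝ) : ℝ :=
  if h : ∃ c, 0 < c ∧ deriv U c = marginalValue δ U G y then h.choose else 1

section HJB

variable {U G : ℝ → ℝ} {γ K₁ δ y y' z : ℝ}

theorem hasDerivWithinAt_optValue (hU : UtilityAssumptions U γ K₁) (hG : RewardAssumptions G)
    (hδ : 0 < δ) (hy : 0 < y) :
    HasDerivWithinAt (optValue δ U G) (marginalValue δ U G y) (Iio y) y := by
  have := (optValue_concaveOn hU hG hδ).neg.hasDerivWithinAt_leftDeriv_of_mem_interior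
    (by rw [interior_Ici]; exact hy)
  simpa [marginalValue] using this.neg

/-- The left derivative of a concave function is a supergradient at interior points, so
differentiability is not needed yet. -/
theorem optValue_le_tangent (hU : UtilityAssumptions U γ K₁) (hG : RewardAssumptions G)
    (hδ : 0 < δ) (hy : 0 < y) (hz : 0 ≤ z) :
    optValue δ U G z ≤ optValue δ U G y + marginalValue δ U G y * (z - y) := by
  have hc := (optValue_concaveOn hU hG hδ).neg
  have hint : y ∈ interior (Ici (0 : ℝ)) := by rw [interior_Ici]; exact hy
  rcases lt_trichotomy z y with h | rfl | h
  · have := hc.slope_le_leftDeriv_of_mem_interior hz hint h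
    rw [slope_def_field, div_le_iff₀ (by linarith)] at this
    simp only [Pi.neg_apply] at this
    unfold marginalValue
    linarith
  · simp
  · have := (hc.leftDeriv_le_rightDeriv_of_mem_interior hint).trans
      (hc.rightDeriv_le_slope_of_mem_interior hint hz h)
    rw [slope_def_field, le_div_iff₀ (by linarith)] at this
    simp only [Pi.neg_apply] at this
    unfold marginalValue
    linarith

theorem marginalValue_antitoneOn (hU : UtilityAssumptions U γ K₁) (hG : RewardAssumptions G)
    (hδ : 0 < δ) : AntitoneOn (marginalValue δ U G) (Ioi 0) := by
  intro y' hy' y hy h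
  rcases h.eq_or_lt with rfl | h
  · rfl
  have h1 := optValue_le_tangent hU hG hδ hy (le_of_lt hy')
  have h2 := optValue_le_tangent hU hG hδ hy' (le_of_lt hy)
  nlinarith

/-- The increment estimate from `y` to `2 * y` is compared with the tangent of the value at `y`,
using `U(3y) - U(2y) ≥ y U'(3y)`. -/
theorem marginalValue_ge (hU : UtilityAssumptions U γ K₁) (hG : RewardAssumptions G)
    (hδ : 0 < δ) (hy : 0 < y) :
    Real.exp (-δ) / 2 * deriv U (3 * y) ≤ marginalValue δ U G y := by
  have h1 := optValue_increment hU hG hδ hy (by linarith : y < 2 * y)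
  have h2 := optValue_le_tangent hU hG hδ hy (by linarith : 0 ≤ 2 * y)
  have h3 := hU.le_tangent (by linarith : 0 < 3 * y) (by linarith : 0 ≤ 2 * y)
  rw [show 2 * y + (2 * y - y) = 3 * y by ring] at h1
  have h4 : Real.exp (-δ) / 2 * (deriv U (3 * y) * y) ≤
      Real.exp (-δ) / 2 * (U (3 * y) - U (2 * y)) :=
    mul_le_mul_of_nonneg_left (by linarith) (by positivity)
  refine le_of_mul_le_mul_right ?_ hy
  linarith

theorem marginalValue_pos (hU : UtilityAssumptions U γ K₁) (hG : RewardAssumptions G)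
    (hδ : 0 < δ) (hy : 0 < y) : 0 < marginalValue δ U G y :=
  (mul_pos (by positivity) (hU.deriv_pos (by linarith))).trans_le (marginalValue_ge hU hG hδ hy)

theorem tendsto_marginalValue (hU : UtilityAssumptions U γ K₁) (hG : RewardAssumptions G)
    (hδ : 0 < δ) : Tendsto (marginalValue δ U G) (𝓝[>] 0) atTop := by
  have h1 : Tendsto (fun y : ℝ => 3 * y) (𝓝[>] 0) (𝓝[>] 0) := by
    refine tendsto_nhdsWithin_iff.2 ⟨?_, ?_⟩
    · have : Tendsto (fun y : ℝ => 3 * y) (𝓝 0) (𝓝 (3 * 0)) :=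
        (continuous_const_mul 3).tendsto 0
      rw [mul_zero] at this
      exact this.mono_left nhdsWithin_le_nhds
    · filter_upwards [self_mem_nhdsWithin] with y hy
      exact mul_pos three_pos (mem_Ioi.1 hy)
  refine tendsto_atTop_mono' _ ?_ ((hU.inada_zero.comp h1).const_mul_atTop
    (by positivity : 0 < Real.exp (-δ) / 2))
  filter_upwards [self_mem_nhdsWithin] with y hy using marginalValue_ge hU hG hδ hy

theorem feedback_spec (hU : UtilityAssumptions U γ K₁) (hG : RewardAssumptions G)
    (hδ : 0 < δ) (hy : 0 < y) :
    0 < feedback δ U G y ∧ deriv U (feedback δ U G y) = marginalValue δ U G y := by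
  have h := hU.exists_deriv_eq (marginalValue_pos hU hG hδ hy)
  rw [feedback, dif_pos h]
  exact h.choose_spec

theorem feedback_monotoneOn (hU : UtilityAssumptions U γ K₁) (hG : RewardAssumptions G)
    (hδ : 0 < δ) : MonotoneOn (feedback δ U G) (Ioi 0) := by
  intro y' hy' y hy h
  obtain ⟨p1, e1⟩ := feedback_spec hU hG hδ hy'
  obtain ⟨p2, e2⟩ := feedback_spec hU hG hδ hy
  rw [← hU.strictAntiOn_deriv.le_iff_ge p2 p1, e1, e2]
  exact marginalValue_antitoneOn hU hG hδ hy' hy h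

theorem continuousAt_reward (hG : RewardAssumptions G) (hy : 0 < y) : ContinuousAt G y := by
  have := hG.concave.continuousOn_interior
  rw [interior_Ici] at this
  exact this.continuousAt (Ioi_mem_nhds hy)

theorem continuousAt_optValue (hU : UtilityAssumptions U γ K₁) (hG : RewardAssumptions G)
    (hδ : 0 < δ) (hy : 0 < y) : ContinuousAt (optValue δ U G) y := by
  have := (optValue_concaveOn hU hG hδ).continuousOn_interior
  rw [interior_Ici] at this
  exact this.continuousAt (Ioi_mem_nhds hy)

/-- The supersolution half of the Hamilton-Jacobi-Bellman equation. -/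
theorem optValue_supersolution (hU : UtilityAssumptions U γ K₁) (hG : RewardAssumptions G)
    (hδ : 0 < δ) (hy : 0 < y) {c₀ : ℝ} (hc₀ : 0 < c₀) :
    U c₀ - c₀ * marginalValue δ U G y + G y ≤ δ * optValue δ U G y := by
  set w := optValue δ U G with hw
  set D := marginalValue δ U G y
  have hlin : HasDerivWithinAt (fun h : ℝ => y - c₀ * h) (-c₀) (Ioi 0) 0 := by
    have := ((hasDerivAt_id (0 : ℝ)).const_mul c₀).const_sub y
    simpa using this.hasDerivWithinAt
  have hmaps : MapsTo (fun h : ℝ => y - c₀ * h) (Ioi 0) (Iio y) := fun h hh => by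
    have := mul_pos hc₀ hh
    simp only [mem_Iio]
    linarith
  -- Consumption moves wealth to the left of `y`, so the left derivative is the one that enters.
  have hw1 : HasDerivWithinAt (fun h => w (y - c₀ * h)) (D * (-c₀)) (Ioi 0) 0 := by
    have h0 : HasDerivWithinAt w D (Iio y) (y - c₀ * 0) := by
      simpa using hasDerivWithinAt_optValue hU hG hδ hy
    exact h0.comp 0 hlin hmaps
  have hexp : HasDerivAt (fun h : ℝ => Real.exp (-δ * h)) (-δ) 0 := by
    simpa using ((hasDerivAt_id (0 : ℝ)).const_mul (-δ)).exp
  have hφ := hexp.hasDerivWithinAt.mul hw1 (s := Ioi 0)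
  have hs1 := (hasDerivWithinAt_iff_tendsto_slope' self_notMem_Ioi).1 hφ
  have hs2 := (hasDerivWithinAt_iff_tendsto_slope' self_notMem_Ioi).1
    (hexp.hasDerivWithinAt (s := Ioi 0))
  have hGc : Tendsto (fun h => G (y - c₀ * h)) (𝓝[>] 0) (𝓝 (G y)) := by
    have h1 : Tendsto (fun h : ℝ => y - c₀ * h) (𝓝[>] 0) (𝓝 y) := by
      simpa using hlin.continuousWithinAt.tendsto
    exact (continuousAt_reward hG hy).tendsto.comp h1
  have hlim := ((hs2.neg.div_const δ).mul (hGc.const_add (U c₀))).add hs1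
  have hle : ∀ᶠ h in 𝓝[>] (0 : ℝ), c₀ * h ≤ y := by
    have : Tendsto (fun h : ℝ => y - c₀ * h) (𝓝[>] 0) (𝓝 y) := by
      simpa using hlin.continuousWithinAt.tendsto
    filter_upwards [this.eventually_const_lt hy] with h hh
    linarith
  have hfin := le_of_tendsto hlim (b := 0) (by
    filter_upwards [hle, self_mem_nhdsWithin] with h hh hpos
    have hpos' : (0 : ℝ) < h := hpos
    have key := optValue_ge_concat hU hG hδ hc₀.le hpos'.le hh
    simp only [slope_def_field, Pi.mul_apply, mul_zero, sub_zero, Real.exp_zero, one_mul]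
    have e : -((Real.exp (-δ * h) - 1) / h) / δ * (U c₀ + G (y - c₀ * h)) +
        (Real.exp (-δ * h) * w (y - c₀ * h) - w y) / h =
        ((1 - Real.exp (-δ * h)) / δ * (U c₀ + G (y - c₀ * h)) +
          Real.exp (-δ * h) * w (y - c₀ * h) - w y) / h := by
      field_simp
      ring
    rw [e]
    exact div_nonpos_of_nonpos_of_nonneg (by linarith) hpos'.le)
  simp only [mul_zero, sub_zero, Real.exp_zero, neg_neg, div_self hδ.ne'] at hfin
  linarith

/-- The Hamilton-Jacobi-Bellman equation. -/
theorem optValue_hjb (hU : UtilityAssumptions U γ K₁) (hG : RewardAssumptions G)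
    (hδ : 0 < δ) (hy : 0 < y) :
    U (feedback δ U G y) - feedback δ U G y * marginalValue δ U G y =
      δ * optValue δ U G y - G y := by
  obtain ⟨hC, hCD⟩ := feedback_spec hU hG hδ hy
  have hD := marginalValue_pos hU hG hδ hy
  refine le_antisymm (by linarith [optValue_supersolution hU hG hδ hy hC]) ?_
  have hcont := hU.continuousOn_sub_mul_deriv.continuousAt (Ioi_mem_nhds hC)
  have hlim : Tendsto (fun c => U c - c * deriv U c) (𝓝[>] (feedback δ U G y))
      (𝓝 (U (feedback δ U G y) - feedback δ U G y * deriv U (feedback δ U G y))) :=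
    hcont.tendsto.mono_left nhdsWithin_le_nhds
  rw [← hCD]
  refine ge_of_tendsto hlim ?_
  filter_upwards [self_mem_nhdsWithin] with c hc
  have hc' : feedback δ U G y < c := hc
  have hc0 : 0 < c := hC.trans hc'
  have hlt : deriv U c < marginalValue δ U G y := hCD ▸ hU.strictAntiOn_deriv hC hc0 hc'
  have hq := hU.deriv_pos hc0
  -- For a rate `c` above the feedback rate, `h` is chosen so that `e^{-δh} = U'(c) / D(y)`, which
  -- is less than `1`; letting `c` decrease to the feedback rate gives the equation.
  have := optValue_le_of_supergradient hU hG hδ hy.le hD.le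
    (fun z hz => optValue_le_tangent hU hG hδ hy hz)
    (h := Real.log (marginalValue δ U G y / deriv U c) / δ)
    (div_pos (Real.log_pos ((one_lt_div hq).2 hlt)) hδ) hc0 (by
      rw [show -δ * (Real.log (marginalValue δ U G y / deriv U c) / δ) =
        -Real.log (marginalValue δ U G y / deriv U c) by field_simp, Real.exp_neg,
        Real.exp_log (div_pos hD hq)]
      field_simp)
  linarith

/-- The equation identifies `U(C) - C U'(C)` with the continuous function `δ w - G`, and the left
side is strictly increasing in `C`. -/
theorem continuousAt_feedback (hU : UtilityAssumptions U γ K₁) (hG : RewardAssumptions G)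
    (hδ : 0 < δ) (hy : 0 < y) : ContinuousAt (feedback δ U G) y := by
  have hcont : ContinuousAt (fun z => δ * optValue δ U G z - G z) y :=
    ((continuousAt_optValue hU hG hδ hy).const_mul δ).sub (continuousAt_reward hG hy)
  have hΓ : ∀ z, 0 < z → U (feedback δ U G z) - feedback δ U G z * deriv U (feedback δ U G z) =
      δ * optValue δ U G z - G z := fun z hz => by
    rw [(feedback_spec hU hG hδ hz).2, optValue_hjb hU hG hδ hz]
  have hpos := fun z (hz : 0 < z) => (feedback_spec hU hG hδ hz).1
  have hmono := hU.strictMonoOn_sub_mul_deriv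
  refine tendsto_order.2 ⟨fun c hc => ?_, fun c hc => ?_⟩
  · rcases le_or_gt c 0 with h0 | h0
    · filter_upwards [Ioi_mem_nhds hy] with z hz using h0.trans_lt (hpos z hz)
    · have h1 : U c - c * deriv U c < δ * optValue δ U G y - G y :=
        hΓ y hy ▸ hmono h0 (hpos y hy) hc
      filter_upwards [Ioi_mem_nhds hy, hcont.tendsto.eventually_const_lt h1] with z hz hlt
      rw [← hΓ z hz] at hlt
      exact (hmono.lt_iff_lt h0 (hpos z hz)).1 hlt
  · have h0 : 0 < c := (hpos y hy).trans hc
    have h1 : δ * optValue δ U G y - G y < U c - c * deriv U c :=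
      hΓ y hy ▸ hmono (hpos y hy) h0 hc
    filter_upwards [Ioi_mem_nhds hy, hcont.tendsto.eventually_lt_const h1] with z hz hlt
    rw [← hΓ z hz] at hlt
    exact (hmono.lt_iff_lt (hpos z hz) h0).1 hlt

theorem continuousAt_marginalValue (hU : UtilityAssumptions U γ K₁) (hG : RewardAssumptions G)
    (hδ : 0 < δ) (hy : 0 < y) : ContinuousAt (marginalValue δ U G) y := by
  obtain ⟨hC, hCD⟩ := feedback_spec hU hG hδ hy
  have h1 : ContinuousAt (fun z => deriv U (feedback δ U G z)) y :=
    ContinuousAt.comp (hU.continuousOn_deriv.continuousAt (Ioi_mem_nhds hC))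
      (continuousAt_feedback hU hG hδ hy)
  refine h1.congr ?_
  filter_upwards [Ioi_mem_nhds hy] with z hz using (feedback_spec hU hG hδ hz).2

/-- The supergradient inequalities at `y` and `z` bound the remainder by `|D(z) - D(y)| |z - y|`,
and `D = U' ∘ C` is continuous. -/
theorem hasDerivAt_optValue (hU : UtilityAssumptions U γ K₁) (hG : RewardAssumptions G)
    (hδ : 0 < δ) (hy : 0 < y) : HasDerivAt (optValue δ U G) (marginalValue δ U G y) y := by
  rw [hasDerivAt_iff_isLittleO, Asymptotics.isLittleO_iff]
  intro ε hε
  have hD := Metric.tendsto_nhds.1 (continuousAt_marginalValue hU hG hδ hy).tendsto ε hε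
  filter_upwards [Ioi_mem_nhds hy, hD] with z hz hDz
  have h1 := optValue_le_tangent hU hG hδ hy (le_of_lt hz)
  have h2 := optValue_le_tangent hU hG hδ hz hy.le
  rw [Real.dist_eq] at hDz
  simp only [smul_eq_mul, Real.norm_eq_abs]
  have h3 : |marginalValue δ U G z - marginalValue δ U G y| * |z - y| ≤ ε * |z - y| :=
    mul_le_mul_of_nonneg_right hDz.le (abs_nonneg _)
  rw [← abs_mul] at h3
  refine le_trans ?_ h3
  rw [abs_of_nonpos (by linarith)]
  refine le_trans ?_ (neg_le_abs _)
  linarith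

/-- The marginal value does not grow too fast when wealth decreases. -/
theorem feedback_mul_marginalValue_sub_le (hU : UtilityAssumptions U γ K₁)
    (hG : RewardAssumptions G) (hδ : 0 < δ) (hy' : 0 < y') (h : y' ≤ y) :
    feedback δ U G y' * (marginalValue δ U G y' - marginalValue δ U G y) ≤
      δ * marginalValue δ U G y' * (y - y') := by
  have hy : 0 < y := hy'.trans_le h
  obtain ⟨p1, e1⟩ := feedback_spec hU hG hδ hy'
  obtain ⟨p2, e2⟩ := feedback_spec hU hG hδ hy
  -- The equations at `y` and `y'` are subtracted. Monotonicity removes `G`, the tangent at `y'`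
  -- bounds the increment of the value, and `mul_deriv_sub_lt` bounds the other side from below.
  have h1 := optValue_hjb hU hG hδ hy
  have h2 := optValue_hjb hU hG hδ hy'
  have h3 := mul_le_mul_of_nonneg_left (optValue_le_tangent hU hG hδ hy' hy.le) hδ.le
  have h4 := hG.mono hy'.le hy.le h
  rcases (feedback_monotoneOn hU hG hδ hy' hy h).eq_or_lt with he | hlt
  · rw [← e1, ← e2, he, sub_self, mul_zero]
    have := hU.deriv_pos p2
    have : 0 ≤ y - y' := by linarith
    positivity
  · have h5 := hU.mul_deriv_sub_lt p1 hlt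
    rw [e1, e2] at h5
    linarith

end HJB

/-! ### The optimal trajectory and its verification. -/

/-- Solution of a scalar autonomous differential equation by separation of variables. -/
theorem exists_flow {k : ℝ → ℝ} (hk : Continuous k) (hpos : ∀ u, 0 < k u) (u₀ : ℝ)
    (htop : Tendsto (fun u => ∫ v in u₀..u, k v) atTop atTop)
    (hbot : Tendsto (fun u => ∫ v in u₀..u, k v) atBot atBot) :
    ∃ φ : ℝ → ℝ, φ 0 = u₀ ∧ ∀ s, HasDerivAt φ (-(k (φ s))⁻¹) s := by
  set Ψ : ℝ → ℝ := fun u => ∫ v in u₀..u, k v with hΨ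
  have hd : ∀ u, HasDerivAt Ψ (k u) u := fun u =>
    intervalIntegral.integral_hasDerivAt_right (hk.intervalIntegrable _ _)
      (hk.stronglyMeasurableAtFilter _ _) hk.continuousAt
  have hmono : StrictMono Ψ := strictMono_of_deriv_pos fun u => by
    rw [(hd u).deriv]; exact hpos u
  have hcont : Continuous Ψ := continuous_iff_continuousAt.2 fun u => (hd u).continuousAt
  -- `Ψ` is signed time as a function of the state; since the state decreases, the solution is its
  -- inverse at `-s`.
  let e := hmono.orderIsoOfSurjective Ψ (hcont.surjective htop hbot)
  have he : ∀ t, Ψ (e.symm t) = t := fun t => e.apply_symm_apply t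
  refine ⟨fun s => e.symm (-s), ?_, fun s => ?_⟩
  · apply hmono.injective
    simp only
    rw [he]
    simp [hΨ]
  · have h1 : HasDerivAt e.symm (k (e.symm (-s)))⁻¹ (-s) :=
      HasDerivAt.of_local_left_inverse e.symm.continuous.continuousAt (hd _) (hpos _).ne'
        (Eventually.of_forall he)
    exact (h1.comp s (hasDerivAt_neg s)).congr_deriv (by simp)

section Trajectory

variable {U G : ℝ → ℝ} {γ K₁ δ x y : ℝ}

/-- With `u = log y`, this is the time spent per unit of `u` under `y' = -C(y)`. Truncation at `x`
freezes the rate above `x`, which makes the flow global also for negative times. -/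
theorem continuous_time_change (hU : UtilityAssumptions U γ K₁) (hG : RewardAssumptions G)
    (hδ : 0 < δ) (hx : 0 < x) :
    Continuous fun u => Real.exp u / feedback δ U G (min (Real.exp u) x) := by
  refine continuous_iff_continuousAt.2 fun u => ?_
  have hpos : 0 < min (Real.exp u) x := lt_min (Real.exp_pos u) hx
  refine Real.continuous_exp.continuousAt.div ?_ (feedback_spec hU hG hδ hpos).1.ne'
  exact ContinuousAt.comp (f := fun u => min (Real.exp u) x)
    (continuousAt_feedback hU hG hδ hpos) (by fun_prop)

/-- Grönwall-type bound on the marginal value. -/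
theorem marginalValue_le_exp (hU : UtilityAssumptions U γ K₁) (hG : RewardAssumptions G)
    (hδ : 0 < δ) (hx : 0 < x) {u : ℝ} (hu : u ≤ Real.log x) :
    marginalValue δ U G (Real.exp u) ≤ marginalValue δ U G x * Real.exp (-((δ + 1) *
      ∫ v in Real.log x..u, Real.exp v / feedback δ U G (min (Real.exp v) x))) := by
  set D := marginalValue δ U G with hD
  set C := feedback δ U G with hC
  set k : ℝ → ℝ := fun v => Real.exp v / C (min (Real.exp v) x) with hk
  have hkc : Continuous k := continuous_time_change hU hG hδ hx
  have hmin : ∀ v, 0 < min (Real.exp v) x := fun v => lt_min (Real.exp_pos v) hx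
  have hkpos : ∀ v, 0 < k v := fun v =>
    div_pos (Real.exp_pos v) (feedback_spec hU hG hδ (hmin v)).1
  set L := Real.log x with hL
  have hDpos : ∀ v, 0 < D (Real.exp v) := fun v => marginalValue_pos hU hG hδ (Real.exp_pos v)
  have hDc : Continuous fun v => D (Real.exp v) := continuous_iff_continuousAt.2 fun v =>
    ContinuousAt.comp (f := Real.exp) (continuousAt_marginalValue hU hG hδ (Real.exp_pos v))
      Real.continuous_exp.continuousAt
  have hΨ : ∀ v, HasDerivAt (fun v => ∫ r in L..v, k r) (k v) v := fun v =>
    intervalIntegral.integral_hasDerivAt_right (hkc.intervalIntegrable _ _)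
      (hkc.stronglyMeasurableAtFilter _ _) hkc.continuousAt
  set f : ℝ → ℝ := fun r => D (Real.exp (L - r)) with hf
  have hfc : Continuous f := hDc.comp (continuous_const.sub continuous_id)
  set B : ℝ → ℝ := fun r => D x * Real.exp (-((δ + 1) * ∫ v in L..(L - r), k v)) with hB
  have hBd : ∀ r, HasDerivAt B (B r * ((δ + 1) * k (L - r))) r := by
    intro r
    have h1 := (hΨ (L - r)).comp r ((hasDerivAt_id r).const_sub L)
    have h2 := ((h1.const_mul (δ + 1)).neg.exp.const_mul (D x))
    refine h2.congr_deriv ?_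
    simp only [hB, Function.comp, Pi.neg_apply]
    ring
  -- The parameter `r` lowers wealth from `x` along `e^{L - r}`. `D` is only known to be continuous,
  -- hence a one-sided slope comparison; the rate `δ + 1` in place of `δ` supplies the strict
  -- inequality it requires.
  have hmain := image_le_of_liminf_slope_right_lt_deriv_boundary' (f := f)
    (f' := fun r => δ * f r * k (L - r)) (a := 0) (b := L - u) hfc.continuousOn ?_
    (B := B) (B' := fun r => B r * ((δ + 1) * k (L - r))) ?_
    (continuous_iff_continuousAt.2 fun r => (hBd r).continuousAt).continuousOn
    (fun r _ => (hBd r).hasDerivWithinAt) ?_ (x := L - u) ⟨by linarith, le_rfl⟩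
  · simpa [hf, hB] using hmain
  · intro r hr q hq
    have hexpL : ∀ z, 0 ≤ z → Real.exp (L - z) ≤ x := fun z hz => by
      rw [← Real.exp_log hx]
      exact Real.exp_le_exp.2 (by linarith)
    have hd : HasDerivAt (fun z => -Real.exp (L - z)) (Real.exp (L - r)) r := by
      have := ((hasDerivAt_id r).const_sub L).exp.neg
      exact this.congr_deriv (by simp)
    have hs := (hasDerivWithinAt_iff_tendsto_slope' self_notMem_Ioi).1
      (hd.hasDerivWithinAt (s := Ioi r))
    have hCc : ContinuousAt (fun z => C (Real.exp (L - z))) r :=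
      ContinuousAt.comp (f := fun z => Real.exp (L - z))
        (continuousAt_feedback hU hG hδ (Real.exp_pos _)) (by fun_prop)
    have hCpos : ∀ z, 0 < C (Real.exp (L - z)) := fun z =>
      (feedback_spec hU hG hδ (Real.exp_pos _)).1
    have hlim : Tendsto (fun z => δ * f z / C (Real.exp (L - z)) *
        slope (fun z => -Real.exp (L - z)) r z) (𝓝[>] r)
        (𝓝 (δ * f r / C (Real.exp (L - r)) * Real.exp (L - r))) :=
      ((((hfc.continuousAt.const_mul δ).div hCc (hCpos r).ne').tendsto.mono_left
        nhdsWithin_le_nhds)).mul hs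
    have he : δ * f r / C (Real.exp (L - r)) * Real.exp (L - r) = δ * f r * k (L - r) := by
      simp only [hk]
      rw [min_eq_left (hexpL r hr.1)]
      ring
    rw [he] at hlim
    refine Eventually.frequently ?_
    filter_upwards [hlim.eventually_lt_const hq, self_mem_nhdsWithin] with z hz hzr
    have hzr' : r < z := hzr
    refine lt_of_le_of_lt ?_ hz
    have h1 := feedback_mul_marginalValue_sub_le hU hG hδ (Real.exp_pos (L - z))
      (Real.exp_le_exp.2 (by linarith : L - z ≤ L - r))
    rw [slope_def_field, slope_def_field, ← mul_div_assoc]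
    refine div_le_div_of_nonneg_right ?_ (by linarith)
    rw [div_mul_eq_mul_div, le_div_iff₀ (hCpos z)]
    simp only [hf]
    linarith
  · simp [hf, hB, hL, Real.exp_log hx]
  · intro r hr hfr
    have h1 : 0 < f r := hDpos _
    have h2 := mul_pos h1 (hkpos (L - r))
    rw [← hfr]
    nlinarith

/-- Reaching wealth `0` takes infinite time: `D` blows up there but is bounded by an exponential of
the elapsed time. Above `x` the frozen rate gives infinite backward time as well. -/
theorem exists_trajectory (hU : UtilityAssumptions U γ K₁) (hG : RewardAssumptions G)
    (hδ : 0 < δ) (hx : 0 < x) :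
    ∃ Y : ℝ → ℝ, Y 0 = x ∧ (∀ s, 0 < Y s) ∧ StrictAnti Y ∧ Continuous Y ∧
      ∀ s, 0 ≤ s → HasDerivAt Y (-feedback δ U G (Y s)) s := by
  set k : ℝ → ℝ := fun v => Real.exp v / feedback δ U G (min (Real.exp v) x) with hk
  have hkc : Continuous k := continuous_time_change hU hG hδ hx
  have hmin : ∀ v, 0 < min (Real.exp v) x := fun v => lt_min (Real.exp_pos v) hx
  have hCpos : ∀ v, 0 < feedback δ U G (min (Real.exp v) x) := fun v =>
    (feedback_spec hU hG hδ (hmin v)).1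
  have hkpos : ∀ v, 0 < k v := fun v => div_pos (Real.exp_pos v) (hCpos v)
  have hCx := (feedback_spec hU hG hδ hx).1
  have htop : Tendsto (fun u => ∫ v in Real.log x..u, k v) atTop atTop := by
    have hlin : Tendsto (fun u => x / feedback δ U G x * (u - Real.log x)) atTop atTop :=
      (tendsto_atTop_add_const_right _ _ tendsto_id).const_mul_atTop (div_pos hx hCx)
    refine tendsto_atTop_mono' _ ?_ hlin
    filter_upwards [eventually_ge_atTop (Real.log x)] with u hu
    have : ∫ v in Real.log x..u, x / feedback δ U G x ≤ ∫ v in Real.log x..u, k v := by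
      refine intervalIntegral.integral_mono_on hu intervalIntegrable_const
        (hkc.intervalIntegrable _ _) fun v hv => ?_
      have hxv : x ≤ Real.exp v := by
        rw [← Real.exp_log hx]
        exact Real.exp_le_exp.2 hv.1
      simp only [hk]
      rw [min_eq_right hxv]
      gcongr
    rw [intervalIntegral.integral_const, smul_eq_mul, mul_comm] at this
    exact this
  have hbot : Tendsto (fun u => ∫ v in Real.log x..u, k v) atBot atBot := by
    have hDx := marginalValue_pos hU hG hδ hx
    have h1 : Tendsto (fun u => marginalValue δ U G (Real.exp u)) atBot atTop :=
      (tendsto_marginalValue hU hG hδ).comp Real.tendsto_exp_atBot_nhdsGT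
    have h2 : Tendsto (fun u => Real.exp (-((δ + 1) * ∫ v in Real.log x..u, k v)))
        atBot atTop := by
      refine tendsto_atTop_mono' _ ?_ (h1.const_mul_atTop (inv_pos.2 hDx))
      filter_upwards [eventually_le_atBot (Real.log x)] with u hu
      rw [inv_mul_le_iff₀ hDx]
      exact marginalValue_le_exp hU hG hδ hx hu
    have h3 : Tendsto (fun u => -((δ + 1) * ∫ v in Real.log x..u, k v)) atBot atTop :=
      Real.tendsto_exp_comp_atTop.1 h2
    have h4 := tendsto_neg_atTop_atBot.comp h3
    refine (h4.const_mul_atBot (by positivity : 0 < (δ + 1)⁻¹)).congr fun u => ?_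
    simp only [Function.comp, neg_neg]
    field_simp
  obtain ⟨φ, hφ0, hφ⟩ := exists_flow hkc hkpos (Real.log x) htop hbot
  have hY : ∀ s, HasDerivAt (fun s => Real.exp (φ s))
      (-feedback δ U G (min (Real.exp (φ s)) x)) s := by
    intro s
    refine (hφ s).exp.congr_deriv ?_
    simp only [hk]
    have := (hCpos (φ s)).ne'
    field_simp
  have hanti : StrictAnti fun s => Real.exp (φ s) := strictAnti_of_deriv_neg fun s => by
    rw [(hY s).deriv]
    exact neg_neg_of_pos (hCpos _)
  refine ⟨fun s => Real.exp (φ s), by simp [hφ0, Real.exp_log hx], fun s => Real.exp_pos _, hanti,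
    continuous_iff_continuousAt.2 fun s => (hY s).continuousAt, fun s hs => ?_⟩
  -- For `s ≥ 0` the truncation at `x` is inactive.
  have hle : Real.exp (φ s) ≤ x := by
    have := hanti.antitone hs
    simpa [hφ0, Real.exp_log hx] using this
  have := hY s
  rwa [min_eq_left hle] at this

/-- The optimal trajectory of the deterministic problem and its main properties. -/
theorem exists_optimal_trajectory (hU : UtilityAssumptions U γ K₁) (hG : RewardAssumptions G)
    (hδ : 0 < δ) (hx : 0 < x) :
    ∃ Y : ℝ → ℝ, (∀ s, 0 < Y s) ∧ StrictAnti Y ∧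
      Continuous (fun s => feedback δ U G (Y s)) ∧
      IsPlan x (fun s => feedback δ U G (Y s)) ∧
      (∀ s, 0 ≤ s → wealthPath 0 x (fun s => feedback δ U G (Y s)) s = Y s) ∧
      (∀ s, 0 ≤ s → HasDerivAt Y (-feedback δ U G (Y s)) s) ∧
      Tendsto Y atTop (𝓝 0) ∧
      payoff δ U G x (fun s => feedback δ U G (Y s)) = ENNReal.ofReal (optValue δ U G x) := by
  obtain ⟨Y, hY0, hpos, hanti, hcont, hd⟩ := exists_trajectory hU hG hδ hx
  have hCpos : ∀ s, 0 < feedback δ U G (Y s) := fun s => (feedback_spec hU hG hδ (hpos s)).1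
  have hCc : Continuous fun s => feedback δ U G (Y s) := continuous_iff_continuousAt.2 fun s =>
    ContinuousAt.comp (f := Y) (continuousAt_feedback hU hG hδ (hpos s)) hcont.continuousAt
  have hint : ∀ s, 0 ≤ s → ∫ u in (0 : ℝ)..s, feedback δ U G (Y u) = x - Y s := by
    intro s hs
    have := intervalIntegral.integral_eq_sub_of_hasDerivAt (f := fun u => -Y u)
      (f' := fun u => feedback δ U G (Y u)) (a := 0) (b := s) (fun u hu => by
        rw [uIcc_of_le hs] at hu
        exact (hd u hu.1).neg.congr_deriv (neg_neg _)) (hCc.intervalIntegrable _ _)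
    rw [this, hY0]
    ring
  have hw : ∀ s, 0 ≤ s → wealthPath 0 x (fun s => feedback δ U G (Y s)) s = Y s := by
    intro s hs
    unfold wealthPath
    rw [hint s hs]
    ring
  have hlim : Tendsto Y atTop (𝓝 0) := by
    refine tendsto_order.2 ⟨fun a ha => Eventually.of_forall fun s => ha.trans (hpos s),
      fun ε hε => ?_⟩
    suffices h : ∃ s, Y s < ε by
      obtain ⟨s, hs⟩ := h
      filter_upwards [eventually_ge_atTop s] with r hr using (hanti.antitone hr).trans_lt hs
    -- If wealth stayed above `ε`, the rate would be at least `C(ε)` and would exhaust `x` by the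
    -- time `x / C(ε)`.
    by_contra! hge
    have hCε := (feedback_spec hU hG hδ hε).1
    have hs0 : 0 ≤ x / feedback δ U G ε := by positivity
    have h1 : ∫ u in (0 : ℝ)..(x / feedback δ U G ε), feedback δ U G ε ≤
        ∫ u in (0 : ℝ)..(x / feedback δ U G ε), feedback δ U G (Y u) :=
      intervalIntegral.integral_mono_on hs0 intervalIntegrable_const (hCc.intervalIntegrable _ _)
        fun u _ => feedback_monotoneOn hU hG hδ hε (hpos u) (hge u)
    rw [hint _ hs0, intervalIntegral.integral_const, smul_eq_mul, sub_zero,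
      div_mul_cancel₀ _ hCε.ne'] at h1
    linarith [hpos (x / feedback δ U G ε)]
  refine ⟨Y, hpos, hanti, hCc, ⟨hCc.measurable, fun s _ => (hCpos s).le, fun s hs =>
    ⟨hCc.intervalIntegrable _ _, ?_⟩⟩, hw, hd, hlim, ?_⟩
  · rw [hint s hs]
    linarith [hpos s]
  -- Verification: by the Hamilton-Jacobi-Bellman equation `g'` is the payoff integrand, and `g`
  -- tends to `0` because the value along the path is at most its initial value.
  · set g : ℝ → ℝ := fun s => -(Real.exp (-δ * s) * optValue δ U G (Y s)) with hg
    set g' : ℝ → ℝ := fun s => Real.exp (-δ * s) * (U (feedback δ U G (Y s)) + G (Y s)) with hg'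
    have hgd : ∀ s ∈ Ici (0 : ℝ), HasDerivAt g (g' s) s := by
      intro s hs
      have h1 := (hasDerivAt_optValue hU hG hδ (hpos s)).comp s (hd s hs)
      have h2 := (((hasDerivAt_id s).const_mul (-δ)).exp.mul h1).neg
      refine h2.congr_deriv ?_
      have h3 := optValue_hjb hU hG hδ (hpos s)
      simp only [id, Function.comp, hg']
      linear_combination (-Real.exp (-δ * s)) * h3
    have hg'pos : ∀ s ∈ Ioi (0 : ℝ), 0 ≤ g' s := fun s _ => mul_nonneg (Real.exp_pos _).le
      (add_nonneg (hU.nonneg (hCpos s).le) (hG.nonneg _ (hpos s).le))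
    have hgl : Tendsto g atTop (𝓝 0) := by
      have hexp : Tendsto (fun s => Real.exp (-δ * s) * optValue δ U G x) atTop (𝓝 0) := by
        have h1 : Tendsto (fun s => -δ * s) atTop atBot :=
          tendsto_id.const_mul_atTop_of_neg (by linarith)
        simpa using (Real.tendsto_exp_atBot.comp h1).mul_const (optValue δ U G x)
      have hneg := hexp.neg
      rw [neg_zero] at hneg
      refine tendsto_of_tendsto_of_tendsto_of_le_of_le' hneg tendsto_const_nhds ?_ ?_
      · filter_upwards [eventually_ge_atTop 0] with s hs
        have hYx : Y s ≤ x := hY0 ▸ hanti.antitone hs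
        have h1 := optValue_le_tangent hU hG hδ hx (hpos s).le
        have h2 := mul_nonneg (marginalValue_pos hU hG hδ hx).le (sub_nonneg.2 hYx)
        exact neg_le_neg (mul_le_mul_of_nonneg_left (by linarith) (Real.exp_pos _).le)
      · exact Eventually.of_forall fun s =>
          neg_nonpos.2 (mul_nonneg (Real.exp_pos _).le optValue_nonneg)
    have hI := integral_Ioi_of_hasDerivAt_of_nonneg' hgd hg'pos hgl
    have hint' := integrableOn_Ioi_deriv_of_nonneg' hgd hg'pos hgl
    have hval : (0 : ℝ) - g 0 = optValue δ U G x := by simp [hg, hY0]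
    rw [hval] at hI
    rw [← hI, ofReal_integral_eq_lintegral_ofReal hint'
      ((ae_restrict_mem measurableSet_Ioi).mono hg'pos)]
    refine setLIntegral_congr_fun measurableSet_Ioi fun s hs => ?_
    simp only [hg']
    rw [hw s (le_of_lt hs)]

end Trajectory

/-! ### Uniqueness and strict monotonicity of the feedback. -/

section Uniqueness

variable {U G : ℝ → ℝ} {γ K₁ δ x y y' : ℝ} {c c' : ℝ → ℝ}

theorem aemeasurable_payoff_integrand (hU : UtilityAssumptions U γ K₁) (hG : RewardAssumptions G)
    (hc : IsPlan y c) : AEMeasurable (fun s =>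
      ENNReal.ofReal (Real.exp (-δ * s) * (U (c s) + G (wealthPath 0 y c s))))
      (volume.restrict (Ioi 0)) := by
  have h1 : AEMeasurable (fun s => U (c s)) (volume.restrict (Ioi 0)) := by
    have hm : Monotone fun z => U (max z 0) := fun a b hab =>
      hU.strictMono.monotoneOn (le_max_right a 0) (le_max_right b 0) (max_le_max_right 0 hab)
    refine (hm.measurable.comp hc.measurable).aemeasurable.congr ?_
    filter_upwards [ae_restrict_mem measurableSet_Ioi] with s hs
    simp only [Function.comp]
    rw [max_eq_left (hc.rate_nonneg s (le_of_lt hs))]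
  have h2 : AEMeasurable (fun s => G (wealthPath 0 y c s)) (volume.restrict (Ioi 0)) := by
    refine aemeasurable_restrict_of_antitoneOn measurableSet_Ioi fun s hs r hr hsr => ?_
    have hs0 : 0 ≤ s := le_of_lt hs
    refine hG.mono (hc.wealthPath_nonneg (le_of_lt hr)) (hc.wealthPath_nonneg hs0) ?_
    have := (hc.shift hs0).wealthPath_le (s := r - s) (by linarith)
    rwa [hc.wealthPath_shift hs0 (by linarith), sub_add_cancel] at this
  exact ((by fun_prop : Measurable fun s => Real.exp (-δ * s)).aemeasurable.mul
    (h1.add h2)).ennreal_ofReal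

/-- Optimal plans coincide where the value function is affine. -/
theorem ae_eq_of_optimal (hU : UtilityAssumptions U γ K₁) (hG : RewardAssumptions G)
    (hδ : 0 < δ) (hc : IsPlan y c) (hc' : IsPlan y' c')
    (ho : payoff δ U G y c = ENNReal.ofReal (optValue δ U G y))
    (ho' : payoff δ U G y' c' = ENNReal.ofReal (optValue δ U G y'))
    (hmid : optValue δ U G (2⁻¹ * y + 2⁻¹ * y') ≤
      2⁻¹ * optValue δ U G y + 2⁻¹ * optValue δ U G y') :
    c =ᵐ[volume.restrict (Ioi 0)] c' := by
  have h2 : (0 : ℝ) ≤ 2⁻¹ := by norm_num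
  have h2s : (2⁻¹ : ℝ) + 2⁻¹ = 1 := by norm_num
  have hm := hc.convexCombination hc' h2 h2
  have hle : ∀ᵐ s ∂(volume.restrict (Ioi (0 : ℝ))), _ :=
    (ae_restrict_mem measurableSet_Ioi).mono fun s hs =>
      payoff_integrand_concave (δ := δ) hU hG hc hc' h2 h2 h2s (le_of_lt hs)
  have hsum : ∫⁻ s in Ioi (0 : ℝ), (ENNReal.ofReal 2⁻¹ *
      ENNReal.ofReal (Real.exp (-δ * s) * (U (c s) + G (wealthPath 0 y c s))) +
      ENNReal.ofReal 2⁻¹ *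
        ENNReal.ofReal (Real.exp (-δ * s) * (U (c' s) + G (wealthPath 0 y' c' s)))) =
      ENNReal.ofReal (2⁻¹ * optValue δ U G y + 2⁻¹ * optValue δ U G y') := by
    rw [lintegral_add_left' ((aemeasurable_payoff_integrand hU hG hc).const_mul _),
      lintegral_const_mul' _ _ ENNReal.ofReal_ne_top,
      lintegral_const_mul' _ _ ENNReal.ofReal_ne_top,
      ENNReal.ofReal_add (mul_nonneg h2 optValue_nonneg) (mul_nonneg h2 optValue_nonneg),
      ENNReal.ofReal_mul h2, ENNReal.ofReal_mul h2, ← ho, ← ho']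
    rfl
  -- The averaged plan dominates pointwise but has no larger integral, so equality holds almost
  -- everywhere; strict concavity of `U` then excludes different rates.
  have hae := ae_eq_of_ae_le_of_lintegral_le hle (by rw [hsum]; exact ENNReal.ofReal_ne_top)
    (aemeasurable_payoff_integrand hU hG hm.1) (by
      rw [hsum]
      exact (payoff_le_optValue hU hG hδ hm.1).trans (ENNReal.ofReal_le_ofReal hmid))
  filter_upwards [hae, ae_restrict_mem measurableSet_Ioi] with s hs hs0
  have hs0' : (0 : ℝ) ≤ s := le_of_lt hs0
  by_contra hne
  rw [hm.2 s hs0'] at hs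
  have h3 := hc.rate_nonneg s hs0'
  have h4 := hc'.rate_nonneg s hs0'
  have h5 := hc.wealthPath_nonneg hs0'
  have h6 := hc'.wealthPath_nonneg hs0'
  have e1 := hU.strictConcave.2 h3 h4 hne (by norm_num : (0 : ℝ) < 2⁻¹)
    (by norm_num : (0 : ℝ) < 2⁻¹) h2s
  have e2 := hG.concave.2 h5 h6 h2 h2 h2s
  simp only [smul_eq_mul] at e1 e2
  have h7 := hU.nonneg h3
  have h8 := hU.nonneg h4
  have h9 := hG.nonneg _ h5
  have h10 := hG.nonneg _ h6
  have hexp := Real.exp_pos (-δ * s)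
  have h11 := mul_lt_mul_of_pos_left (add_lt_add_of_lt_of_le e1 e2) hexp
  have h12 : 0 ≤ Real.exp (-δ * s) * (U (c s) + G (wealthPath 0 y c s)) := by positivity
  have h13 : 0 ≤ Real.exp (-δ * s) * (U (c' s) + G (wealthPath 0 y' c' s)) := by positivity
  rw [← ENNReal.ofReal_mul h2, ← ENNReal.ofReal_mul h2, ← ENNReal.ofReal_add (by positivity)
    (by positivity)] at hs
  refine hs.not_lt ((ENNReal.ofReal_lt_ofReal_iff (lt_of_le_of_lt ?_ h11)).2 ?_)
  · positivity
  · linarith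

/-- Equal slopes make the midpoint value at most the average, so the optimal plans from `y` and `y'`
coincide. The two wealths then differ by the constant `y - y'`, although both tend to `0`. Strict
concavity of `G` is not needed. -/
theorem marginalValue_strictAntiOn (hU : UtilityAssumptions U γ K₁) (hG : RewardAssumptions G)
    (hδ : 0 < δ) : StrictAntiOn (marginalValue δ U G) (Ioi 0) := by
  intro y hy y' hy' hlt
  refine lt_of_le_of_ne (marginalValue_antitoneOn hU hG hδ hy hy' hlt.le) fun heq => ?_
  have hy0 : 0 < y := hy
  have hy0' : 0 < y' := hy'
  obtain ⟨Y, -, -, -, hp, hw, -, hlim, ho⟩ := exists_optimal_trajectory hU hG hδ hy0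
  obtain ⟨Y', -, -, -, hp', hw', -, hlim', ho'⟩ := exists_optimal_trajectory hU hG hδ hy0'
  have hae := ae_eq_of_optimal hU hG hδ hp hp' ho ho' (by
    have hmid : 0 ≤ 2⁻¹ * y + 2⁻¹ * y' := by positivity
    have h1 := optValue_le_tangent hU hG hδ hy0 hmid
    have h2 := optValue_le_tangent hU hG hδ hy0' hmid
    rw [heq] at h2
    linarith)
  have hdiff : ∀ s, 0 ≤ s → Y s - Y' s = y - y' := by
    intro s hs
    rw [← hw s hs, ← hw' s hs]
    unfold wealthPath
    rw [intervalIntegral.integral_of_le hs, intervalIntegral.integral_of_le hs,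
      integral_congr_ae (ae_restrict_of_ae_restrict_of_subset Ioc_subset_Ioi_self hae)]
    ring
  have h1 := hlim.sub hlim'
  have h2 : Tendsto (fun s => Y s - Y' s) atTop (𝓝 (y - y')) :=
    tendsto_const_nhds.congr' (by
      filter_upwards [eventually_ge_atTop 0] with s hs using (hdiff s hs).symm)
  have := tendsto_nhds_unique h1 h2
  linarith

theorem feedback_strictMonoOn (hU : UtilityAssumptions U γ K₁) (hG : RewardAssumptions G)
    (hδ : 0 < δ) : StrictMonoOn (feedback δ U G) (Ioi 0) := by
  intro y' hy' y hy h
  obtain ⟨p1, e1⟩ := feedback_spec hU hG hδ hy'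
  obtain ⟨p2, e2⟩ := feedback_spec hU hG hδ hy
  rw [← hU.strictAntiOn_deriv.lt_iff_gt p2 p1, e1, e2]
  exact marginalValue_strictAntiOn hU hG hδ hy' hy h

theorem tendsto_feedback (hU : UtilityAssumptions U γ K₁) (hG : RewardAssumptions G)
    (hδ : 0 < δ) : Tendsto (feedback δ U G) (𝓝[>] 0) (𝓝 0) := by
  refine tendsto_order.2 ⟨fun a ha => ?_, fun ε hε => ?_⟩
  · filter_upwards [self_mem_nhdsWithin] with y hy
    exact ha.trans (feedback_spec hU hG hδ hy).1
  · filter_upwards [self_mem_nhdsWithin,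
      (tendsto_marginalValue hU hG hδ).eventually_gt_atTop (deriv U ε)] with y hy hgt
    obtain ⟨p, e⟩ := feedback_spec hU hG hδ hy
    rw [← e] at hgt
    exact (hU.strictAntiOn_deriv.lt_iff_gt hε p).1 hgt

end Uniqueness

/-! ### Reduction of the auxiliary problem to the autonomous one. -/

section Shift

variable {Ω : Type*} [MeasurableSpace Ω] {M : Market Ω} {P : Measure Ω}
  {lam : ℝ} {p : Kernel ℝ≥0 ℝ} {zlo : ℝ} {zhi : EReal} {k b γ ρ : ℝ} {U : ℝ → ℝ} {K₁ : ℝ}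
  {l t x a : ℝ} {c : ℝ → ℝ}

/-- The reward rate `y ↦ g(0, l(a) + y, a)` as a real function. -/
def rewardRate (M : Market Ω) (P : Measure Ω) (U : ℝ → ℝ) (ρ lam : ℝ) (p : Kernel ℝ≥0 ℝ)
    (zlo : ℝ) (zhi : EReal) (a y : ℝ) : ℝ :=
  (gFun M P U ρ lam p 0 (minWealth zlo zhi a + y) a).toReal

theorem ofReal_rewardRate [IsProbabilityMeasure P] (hU : UtilityAssumptions U γ K₁)
    (hobs : ObservationAssumptions M P lam p zlo zhi k b) (hρ : 0 < ρ)
    (hgrowth : b * γ + lam * (k ^ γ / zlo ^ γ - 1) < ρ) (hstat : ∀ s t : ℝ≥0, p s = p t)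
    (ha : a ∈ investSet zhi) (s : ℝ) {y : ℝ} (hy : 0 ≤ y) :
    ENNReal.ofReal (rewardRate M P U ρ lam p zlo zhi a y) =
      gFun M P U ρ lam p s (minWealth zlo zhi a + y) a := by
  rw [rewardRate, ENNReal.ofReal_toReal, gFun_eq_of_stationary hstat 0 s]
  exact gFun_ne_top hU hobs hρ hgrowth hstat ha (by linarith) 0

theorem rewardAssumptions_rewardRate [IsProbabilityMeasure P] (hU : UtilityAssumptions U γ K₁)
    (hobs : ObservationAssumptions M P lam p zlo zhi k b) (hρ : 0 < ρ)
    (hgrowth : b * γ + lam * (k ^ γ / zlo ^ γ - 1) < ρ) (hstat : ∀ s t : ℝ≥0, p s = p t)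
    (ha : a ∈ investSet zhi) :
    RewardAssumptions (rewardRate M P U ρ lam p zlo zhi a) := by
  have hg : ∀ y, 0 ≤ y → ENNReal.ofReal (rewardRate M P U ρ lam p zlo zhi a y) =
      gFun M P U ρ lam p 0 (minWealth zlo zhi a + y) a := fun y hy =>
    ofReal_rewardRate hU hobs hρ hgrowth hstat ha 0 hy
  have h0 : ∀ y, 0 ≤ rewardRate M P U ρ lam p zlo zhi a y := fun y => ENNReal.toReal_nonneg
  refine ⟨⟨convex_Ici 0, fun y hy y' hy' θ θ' hθ hθ' hsum => ?_⟩, fun y hy y' hy' hyy' => ?_,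
    fun y _ => h0 y⟩
  · have hy0 : 0 ≤ y := hy
    have hy0' : 0 ≤ y' := hy'
    simp only [smul_eq_mul]
    rw [← ENNReal.ofReal_le_ofReal_iff (h0 _), ENNReal.ofReal_add (mul_nonneg hθ (h0 _))
      (mul_nonneg hθ' (h0 _)), ENNReal.ofReal_mul hθ, ENNReal.ofReal_mul hθ', hg y hy, hg y' hy',
      hg _ (by positivity)]
    refine (gFun_concave hU hobs ha 0 (by linarith) (by linarith) hθ hθ' hsum).trans
      (le_of_eq ?_)
    congr 1
    linear_combination minWealth zlo zhi a * hsum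
  · rw [← ENNReal.ofReal_le_ofReal_iff (h0 _), hg y hy, hg y' hy']
    exact gFun_mono (by linarith)

theorem wealthPath_add_right (l t x : ℝ) (c : ℝ → ℝ) (s : ℝ) :
    wealthPath t x c (s + t) = l + wealthPath 0 (x - l) (fun u => c (u + t)) s := by
  unfold wealthPath
  rw [intervalIntegral.integral_comp_add_right (fun u => c u), zero_add]
  ring

theorem mem_consumptions_iff :
    c ∈ consumptions l t x ↔ IsPlan (x - l) (fun u => c (u + t)) := by
  constructor
  · rintro ⟨h1, h2, h3⟩
    refine ⟨h1.comp (measurable_id.add_const t), fun s hs => h2 _ (by linarith), fun s hs => ?_⟩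
    obtain ⟨h4, h5⟩ := h3 (s + t) (by linarith)
    rw [intervalIntegral.integral_comp_add_right (fun u => c u), zero_add]
    exact ⟨by simpa using h4.comp_add_right t, h5⟩
  · rintro ⟨h1, h2, h3⟩
    have hc : c = (fun u => c (u + t)) ∘ fun s => s - t := by
      funext s
      simp
    refine ⟨?_, fun s hs => ?_, fun s hs => ?_⟩
    · rw [hc]
      exact h1.comp (measurable_id.sub_const t)
    · simpa using h2 (s - t) (by linarith)
    · obtain ⟨h4, h5⟩ := h3 (s - t) (by linarith)
      rw [intervalIntegral.integral_comp_add_right (fun u => c u), zero_add,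
        sub_add_cancel] at h5
      exact ⟨by simpa using h4.comp_sub_right t, h5⟩

/-- Stationarity is what allows the starting time to be moved to `0`: the reward at `s + t` equals
the reward at `0`. -/
theorem auxPayoff_eq_payoff [IsProbabilityMeasure P] (hU : UtilityAssumptions U γ K₁)
    (hobs : ObservationAssumptions M P lam p zlo zhi k b) (hρ : 0 < ρ)
    (hgrowth : b * γ + lam * (k ^ γ / zlo ^ γ - 1) < ρ) (hstat : ∀ s t : ℝ≥0, p s = p t)
    (ha : a ∈ investSet zhi) (hc : IsPlan (x - minWealth zlo zhi a) (fun u => c (u + t))) :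
    auxPayoff M P U ρ lam p t x a c =
      payoff (ρ + lam) U (rewardRate M P U ρ lam p zlo zhi a) (x - minWealth zlo zhi a)
        (fun u => c (u + t)) := by
  unfold auxPayoff payoff
  have hmp : MeasurePreserving (fun s : ℝ => s + t) volume volume :=
    measurePreserving_add_right volume t
  have hpre : (fun s : ℝ => s + t) ⁻¹' Ioi t = Ioi 0 := by ext; simp
  rw [← hmp.setLIntegral_comp_preimage_emb (measurableEmbedding_addRight t) _ (Ioi t), hpre]
  refine setLIntegral_congr_fun measurableSet_Ioi fun s hs => ?_
  have hs0 : 0 ≤ s := le_of_lt hs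
  have hY := hc.wealthPath_nonneg hs0
  simp only
  rw [wealthPath_add_right (minWealth zlo zhi a), add_sub_cancel_right,
    ← ofReal_rewardRate hU hobs hρ hgrowth hstat ha (s + t) hY,
    ← ENNReal.ofReal_add (hU.nonneg (hc.rate_nonneg s hs0))
      ((rewardAssumptions_rewardRate hU hobs hρ hgrowth hstat ha).nonneg _ hY),
    ← ENNReal.ofReal_mul (Real.exp_pos _).le]

theorem isOptimal_iff [IsProbabilityMeasure P] (hU : UtilityAssumptions U γ K₁)
    (hobs : ObservationAssumptions M P lam p zlo zhi k b) (hρ : 0 < ρ)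
    (hgrowth : b * γ + lam * (k ^ γ / zlo ^ γ - 1) < ρ) (hstat : ∀ s t : ℝ≥0, p s = p t)
    (ha : a ∈ investSet zhi) :
    IsOptimal M P U ρ lam p zlo zhi t x a c ↔
      IsPlan (x - minWealth zlo zhi a) (fun u => c (u + t)) ∧
        payoff (ρ + lam) U (rewardRate M P U ρ lam p zlo zhi a) (x - minWealth zlo zhi a)
          (fun u => c (u + t)) = ENNReal.ofReal (optValue (ρ + lam) U
            (rewardRate M P U ρ lam p zlo zhi a) (x - minWealth zlo zhi a)) := by
  have hδ : 0 < ρ + lam := add_pos hρ hobs.lam_pos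
  have hG := rewardAssumptions_rewardRate hU hobs hρ hgrowth hstat ha
  have hval : auxValue M P U ρ lam p zlo zhi t x a = ENNReal.ofReal (optValue (ρ + lam) U
      (rewardRate M P U ρ lam p zlo zhi a) (x - minWealth zlo zhi a)) := by
    rw [← iSup_payoff_eq hU hG hδ, auxValue]
    refine le_antisymm (iSup₂_le fun c hc => ?_) (iSup₂_le fun c hc => ?_)
    · have hc' := mem_consumptions_iff.1 hc
      rw [auxPayoff_eq_payoff hU hobs hρ hgrowth hstat ha hc']
      exact le_iSup₂_of_le _ hc' le_rfl
    · have hcc : (fun u => (fun s => c (s - t)) (u + t)) = c := by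
        funext u
        simp
      have hc' : IsPlan (x - minWealth zlo zhi a) (fun u => (fun s => c (s - t)) (u + t)) := by
        rwa [hcc]
      have := auxPayoff_eq_payoff (x := x) (t := t) (c := fun s => c (s - t)) hU hobs hρ hgrowth
        hstat ha hc'
      rw [hcc] at this
      rw [← this]
      exact le_iSup₂_of_le _ (mem_consumptions_iff.2 hc') le_rfl
  rw [IsOptimal, mem_consumptions_iff, hval]
  exact and_congr_right fun hc => by rw [auxPayoff_eq_payoff hU hobs hρ hgrowth hstat ha hc]

theorem ae_eq_of_shift_ae_eq {c c' : ℝ → ℝ}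
    (h : (fun u => c (u + t)) =ᵐ[volume.restrict (Ioi 0)] fun u => c' (u + t)) :
    c =ᵐ[volume.restrict (Ici t)] c' := by
  have hmp : MeasurePreserving (fun s : ℝ => s - t) volume volume :=
    measurePreserving_sub_right volume t
  have hpre : (fun s : ℝ => s - t) ⁻¹' Ioi 0 = Ioi t := by ext; simp
  have hr := hmp.restrict_preimage (measurableSet_Ioi (a := (0 : ℝ)))
  rw [hpre] at hr
  rw [← restrict_Ioi_eq_restrict_Ici]
  filter_upwards [hr.quasiMeasurePreserving.ae h] with s hs
  simpa using hs

end Shift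

section Zero

variable {U G : ℝ → ℝ} {γ K₁ δ : ℝ}

/-- Without disposable wealth, not consuming is optimal. -/
theorem payoff_zero_eq (hU : UtilityAssumptions U γ K₁) (hG : RewardAssumptions G) (hδ : 0 < δ) :
    payoff δ U G 0 (fun _ => 0) = ENNReal.ofReal (optValue δ U G 0) := by
  refine le_antisymm (payoff_le_optValue hU hG hδ (isPlan_zero le_rfl)) ?_
  rw [← iSup_payoff_eq hU hG hδ]
  refine iSup₂_le fun c hc => ?_
  have h0 : ∫⁻ s in Ioi (0 : ℝ), ENNReal.ofReal (c s) = 0 :=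
    le_antisymm (hc.lintegral_le.trans (by simp)) bot_le
  rw [lintegral_eq_zero_iff hc.measurable.ennreal_ofReal] at h0
  refine lintegral_mono_ae ?_
  filter_upwards [h0, ae_restrict_mem measurableSet_Ioi] with s hs hs0
  have hs0' : (0 : ℝ) ≤ s := le_of_lt hs0
  have hcs : c s = 0 := le_antisymm (ENNReal.ofReal_eq_zero.1 hs) (hc.rate_nonneg s hs0')
  have hY : wealthPath 0 0 c s = 0 := le_antisymm (hc.wealthPath_le hs0')
    (hc.wealthPath_nonneg hs0')
  rw [hcs, hY]
  simp [wealthPath]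

end Zero

end IlliquidMarket

end

/-! ### Assembly in the original coordinates. -/

open IlliquidMarket in
theorem mainTheorem9 {Ω : Type*} [MeasurableSpace Ω] (P : Measure Ω) [IsProbabilityMeasure P]
    (M : Market Ω) (lam : ℝ) (p : Kernel ℝ≥0 ℝ) (zlo : ℝ) (zhi : EReal) (k b : ℝ)
    (hobs : ObservationAssumptions M P lam p zlo zhi k b)
    (U : ℝ → ℝ) (γ K₁ : ℝ) (hU : UtilityAssumptions U γ K₁)
    (ρ : ℝ) (hρ : 0 < ρ) (hgrowth : b * γ + lam * (k ^ γ / zlo ^ γ - 1) < ρ)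
    (hstat : ∀ s t : ℝ≥0, p s = p t)
    (a : ℝ) (ha : a ∈ investSet zhi) (t : ℝ) (ht : 0 ≤ t)
    (x : ℝ) (hx : minWealth zlo zhi a ≤ x) :
    ∃ c : ℝ → ℝ, IsOptimal M P U ρ lam p zlo zhi t x a c ∧
      (∀ c' : ℝ → ℝ, IsOptimal M P U ρ lam p zlo zhi t x a c' →
        c' =ᵐ[volume.restrict (Ici t)] c) ∧
      (x = minWealth zlo zhi a →
        ∀ s, t ≤ s → c s = 0 ∧ wealthPath t x c s = minWealth zlo zhi a) ∧
      (minWealth zlo zhi a < x →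
        ContinuousOn c (Ici t) ∧
        (∀ s, t ≤ s → 0 < c s) ∧
        StrictAntiOn c (Ici t) ∧
        StrictAntiOn (wealthPath t x c) (Ici t) ∧
        StrictConvexOn ℝ (Ici t) (wealthPath t x c) ∧
        Tendsto c atTop (𝓝 0) ∧
        Tendsto (wealthPath t x c) atTop (𝓝 (minWealth zlo zhi a))) := by
  set l := minWealth zlo zhi a with hl
  set G := rewardRate M P U ρ lam p zlo zhi a with hGdef
  have hδ : 0 < ρ + lam := add_pos hρ hobs.lam_pos
  have hG : RewardAssumptions G := rewardAssumptions_rewardRate hU hobs hρ hgrowth hstat ha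
  have hopt := fun c => isOptimal_iff (t := t) (x := x) (c := c) hU hobs hρ hgrowth hstat ha
  have huniq : ∀ c, IsOptimal M P U ρ lam p zlo zhi t x a c →
      ∀ c', IsOptimal M P U ρ lam p zlo zhi t x a c' →
        c' =ᵐ[volume.restrict (Ici t)] c := by
    intro c hc c' hc'
    obtain ⟨h1, h2⟩ := (hopt c).1 hc
    obtain ⟨h1', h2'⟩ := (hopt c').1 hc'
    -- Both plans start from the same wealth, so the midpoint condition is an equality.
    refine ae_eq_of_shift_ae_eq (ae_eq_of_optimal hU hG hδ h1' h1 h2' h2 (le_of_eq ?_))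
    rw [← add_mul, ← add_mul]
    norm_num
  rcases hx.eq_or_lt with hxl | hxl
  · have h0 : IsOptimal M P U ρ lam p zlo zhi t x a (fun _ => 0) := by
      rw [hopt, ← hl, ← hxl, sub_self]
      exact ⟨isPlan_zero le_rfl, payoff_zero_eq hU hG hδ⟩
    exact ⟨fun _ => 0, h0, huniq _ h0, fun _ s _ => ⟨rfl, by simp [wealthPath, hxl]⟩,
      fun h => absurd hxl h.ne⟩
  · obtain ⟨Y, hpos, hanti, hcont, hplan, hw, -, hlim, ho⟩ :=
      exists_optimal_trajectory hU hG hδ (sub_pos.2 hxl)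
    set C := feedback (ρ + lam) U G with hC
    set c : ℝ → ℝ := fun s => C (Y (s - t)) with hc
    have hshift : (fun u => c (u + t)) = fun u => C (Y u) := by
      funext u
      simp [hc]
    have h0 : IsOptimal M P U ρ lam p zlo zhi t x a c := by
      rw [hopt, hshift]
      exact ⟨hplan, ho⟩
    have hcc : Continuous c := hcont.comp (continuous_id.sub continuous_const)
    have hca : StrictAnti c := fun s r hsr =>
      feedback_strictMonoOn hU hG hδ (hpos _) (hpos _) (hanti (by linarith))
    have hwp : ∀ s, t ≤ s → wealthPath t x c s = l + Y (s - t) := by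
      intro s hs
      have h1 := wealthPath_add_right l t x c (s - t)
      rw [sub_add_cancel, hshift, hw _ (by linarith)] at h1
      exact h1
    have hd : ∀ s, HasDerivAt (wealthPath t x c) (-c s) s := fun s =>
      (intervalIntegral.integral_hasDerivAt_right (hcc.intervalIntegrable _ _)
        (hcc.stronglyMeasurableAtFilter _ _) hcc.continuousAt).const_sub x
    have htend : Tendsto (fun s => s - t) atTop atTop := tendsto_atTop_add_const_right _ _ tendsto_id
    refine ⟨c, h0, huniq _ h0, fun h => absurd h hxl.ne', fun _ => ⟨hcc.continuousOn,
      fun s _ => (feedback_spec hU hG hδ (hpos _)).1, hca.strictAntiOn _, ?_, ?_, ?_, ?_⟩⟩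
    · intro s hs r hr hsr
      rw [hwp s hs, hwp r hr]
      linarith [hanti (by linarith : s - t < r - t)]
    -- The derivative of the wealth path is `-c`, which is strictly increasing.
    · refine StrictMonoOn.strictConvexOn_of_deriv (convex_Ici t)
        (continuous_iff_continuousAt.2 fun s => (hd s).continuousAt).continuousOn ?_
      intro s _ r _ hsr
      rw [(hd s).deriv, (hd r).deriv]
      exact neg_lt_neg (hca hsr)
    · have h1 : Tendsto Y atTop (𝓝[>] 0) :=
        tendsto_nhdsWithin_iff.2 ⟨hlim, Eventually.of_forall hpos⟩
      exact ((tendsto_feedback hU hG hδ).comp h1).comp htend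
    · have h1 : Tendsto (fun s => l + Y (s - t)) atTop (𝓝 (l + 0)) :=
        (hlim.comp htend).const_add l
      rw [add_zero] at h1
      refine h1.congr' ?_
      filter_upwards [eventually_ge_atTop t] with s hs using (hwp s hs).symm
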